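/- Let $\mathbb F$ be an algebraically closed field of any characteristic. A *variety* over $\mathbb F$ is a reduced separated scheme of finite type over $\mathbb F$ (possibly reducible, possibly singular). For a variety $X$ let $\mathcal D_X$ be the sheaf of Grothendieck differential operators on $X$ over $\mathbb F$. Call $X$ *D-affine* if the functor $\Gamma(X,-)$ from the category of $\mathcal O_X$-quasicoherent left $\mathcal D_X$-modules to the category of left $\Gamma(X,\mathcal D_X)$-modules is exact, and every $\mathcal O_X$-quasicoherent left $\mathcal D_X$-module $\mathcal F$ with $\Gamma(X,\mathcal F)=0$ is zero. A non-empty effective Cartier divisor $C\subset X$ is *contractible* if there are a variety $\widetilde X$ over $\mathbb F$, a morphism $f\colon X\to\widetilde X$ over $\mathbb F$ and a finite closed subset $T\subset\widetilde X$ such that $C=f^{-1}(T)$ as sets and $f$ restricts to an isomorphism $X\setminus C\to\widetilde X\setminus T$. (For example, $C$ is the exceptional divisor when $X$ is the blow-up of $\widetilde X$ in a closed subscheme supported at finitely many points.) **Theorem.** Let $X$ be a projective D-affine variety over $\mathbb F$ all of whose irreducible components have dimension at least $2$ (for irreducible $X$: $\dim X\ge 2$). Then $X$ has no contractible effective Cartier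 divisor. -/

import Mathlib

open CategoryTheory AlgebraicGeometry TopologicalSpace Opposite

universe u

namespace DAffinity

/-! ### Grothendieck differential operators on a commutative ring -/

section Algebra

variable {A : Type u} [CommRing A]

/-- The commutator `[P, a]` of an additive endomorphism `P` of a commutative ring `A` with the
operator of multiplication by `a`. -/
def commMul (P : AddMonoid.End A) (a : A) : AddMonoid.End A :=
  P * AddMonoid.End.mulLeft a - AddMonoid.End.mulLeft a * P

/-- Grothendieck's inductive definition: the zero operator is the only one of order `< 0`, and `P`
has order `< n + 1` if all commutators `[P, a]`, `a ∈ A`, have order `< n`. -/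
def OrderLT : ℕ → AddMonoid.End A → Prop
  | 0, P => P = 0
  | n + 1, P => ∀ a : A, OrderLT n (commMul P a)

@[simp] lemma commMul_apply (P : AddMonoid.End A) (a g : A) :
    commMul P a g = P (a * g) - a * P g := rfl

lemma commMul_zero (a : A) : commMul (0 : AddMonoid.End A) a = 0 := by
  ext g; simp

lemma commMul_add (P Q : AddMonoid.End A) (a : A) :
    commMul (P + Q) a = commMul P a + commMul Q a := by
  ext g
  change P (a * g) + Q (a * g) - a * (P g + Q g) = (P (a * g) - a * P g) + (Q (a * g) - a * Q g)
  ring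

lemma commMul_neg (P : AddMonoid.End A) (a : A) : commMul (-P) a = -commMul P a := by
  ext g
  change -P (a * g) - a * -P g = -(P (a * g) - a * P g)
  ring

lemma commMul_mul (P Q : AddMonoid.End A) (a : A) :
    commMul (P * Q) a = P * commMul Q a + commMul P a * Q := by
  ext g
  change P (Q (a * g)) - a * P (Q g) = P (Q (a * g) - a * Q g) + (P (a * Q g) - a * P (Q g))
  rw [map_sub]
  ring

lemma commMul_mulLeft (a b : A) : commMul (AddMonoid.End.mulLeft b) a = 0 := by
  ext g
  change b * (a * g) - a * (b * g) = 0
  ring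

lemma OrderLT.zero (n : ℕ) : OrderLT n (0 : AddMonoid.End A) := by
  induction n with
  | zero => rfl
  | succ n ih => intro a; rw [commMul_zero]; exact ih

lemma OrderLT.succ {n : ℕ} {P : AddMonoid.End A} (h : OrderLT n P) : OrderLT (n + 1) P := by
  induction n generalizing P with
  | zero => intro a; rw [show P = 0 from h, commMul_zero]; rfl
  | succ n ih => intro a; exact ih (h a)

lemma OrderLT.mono {m n : ℕ} (hmn : m ≤ n) {P : AddMonoid.End A} (h : OrderLT m P) :
    OrderLT n P := by
  induction n, hmn using Nat.le_induction with
  | base => exact h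
  | succ n _ ih => exact ih.succ

lemma OrderLT.add {n : ℕ} {P Q : AddMonoid.End A} (hP : OrderLT n P) (hQ : OrderLT n Q) :
    OrderLT n (P + Q) := by
  induction n generalizing P Q with
  | zero => rw [show P = 0 from hP, show Q = 0 from hQ, add_zero]; rfl
  | succ n ih => intro a; rw [commMul_add]; exact ih (hP a) (hQ a)

lemma OrderLT.neg {n : ℕ} {P : AddMonoid.End A} (hP : OrderLT n P) : OrderLT n (-P) := by
  induction n generalizing P with
  | zero => rw [show P = 0 from hP, neg_zero]; rfl
  | succ n ih => intro a; rw [commMul_neg]; exact ih (hP a)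

lemma OrderLT.mul {k m n : ℕ} (hk : m + n = k) {P Q : AddMonoid.End A} (hP : OrderLT m P)
    (hQ : OrderLT n Q) : OrderLT k (P * Q) := by
  induction k generalizing m n P Q with
  | zero =>
    obtain rfl : m = 0 := by omega
    rw [show P = 0 from hP, zero_mul]; rfl
  | succ k ih =>
    match m, n with
    | 0, n => rw [show P = 0 from hP, zero_mul]; exact .zero _
    | m + 1, 0 => rw [show Q = 0 from hQ, mul_zero]; exact .zero _
    | m + 1, n + 1 =>
      intro a
      rw [commMul_mul]
      exact (ih (by omega) hP (hQ a)).add (ih (by omega) (hP a) hQ)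

lemma OrderLT.mulLeft (b : A) : OrderLT 1 (AddMonoid.End.mulLeft b) := fun a =>
  commMul_mulLeft a b

end Algebra

/-! ### The sheaf of Grothendieck differential operators -/

section Sheaf

variable {F : Type u} [Field F] {X : Scheme.{u}} (π : X ⟶ Spec (CommRingCat.of F))

/-- Restriction of functions. -/
def res {V W : X.Opens} (h : W ≤ V) : Γ(X, V) →+* Γ(X, W) :=
  (X.presheaf.map (homOfLE h).op).hom

lemma res_res {U V W : X.Opens} (h : V ≤ U) (h' : W ≤ V) (g : Γ(X, U)) :
    res h' (res h g) = res (h'.trans h) g := by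
  simp only [res, ← CommRingCat.comp_apply, ← Functor.map_comp]
  rfl

/-- The structure map `F → Γ(X, V)` of the `F`-scheme `X`. -/
noncomputable def scalar (V : X.Opens) : F →+* Γ(X, V) :=
  (res (le_top : V ≤ ⊤)).comp
    (π.appTop.hom.comp (Scheme.ΓSpecIso (CommRingCat.of F)).inv.hom)

lemma res_scalar {V W : X.Opens} (h : W ≤ V) (c : F) :
    res h (scalar π V c) = scalar π W c := by
  simp only [scalar, RingHom.comp_apply, res_res]

/-- `𝒟_X(U)`: the `F`-linear endomorphisms of the sheaf `𝒪_X|_U` that are, locally on `U`,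
differential operators of finite order. Such an endomorphism is given by the family of its
components on the open sets `V ≤ U`. -/
def diffOps (U : X.Opens) : Subring (∀ V : {V : X.Opens // V ≤ U}, AddMonoid.End Γ(X, V.1)) where
  carrier := { P |
    (∀ (V W : {V : X.Opens // V ≤ U}) (h : W.1 ≤ V.1) (g : Γ(X, V.1)),
      res h (P V g) = P W (res h g)) ∧
    (∀ (V : {V : X.Opens // V ≤ U}) (c : F) (g : Γ(X, V.1)),
      P V (scalar π V.1 c * g) = scalar π V.1 c * P V g) ∧
    (∀ x ∈ U, ∃ (W : X.Opens) (hW : W ≤ U), x ∈ W ∧ ∃ n : ℕ,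
      ∀ (V : X.Opens) (hV : V ≤ W), OrderLT n (P ⟨V, hV.trans hW⟩)) }
  zero_mem' := by
    refine ⟨fun V W h g => by simp, fun V c g => by simp, fun x hx => ?_⟩
    exact ⟨U, le_rfl, hx, 0, fun V hV => rfl⟩
  one_mem' := by
    refine ⟨fun V W h g => by simp, fun V c g => by simp, fun x hx => ?_⟩
    refine ⟨U, le_rfl, hx, 1, fun V hV a => ?_⟩
    ext g
    simp
  add_mem' := by
    rintro P Q ⟨hP₁, hP₂, hP₃⟩ ⟨hQ₁, hQ₂, hQ₃⟩
    refine ⟨fun V W h g => ?_, fun V c g => ?_, fun x hx => ?_⟩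
    · change res h (P V g + Q V g) = P W (res h g) + Q W (res h g)
      rw [map_add, hP₁ V W h, hQ₁ V W h]
    · change P V _ + Q V _ = _ * (P V g + Q V g)
      rw [hP₂, hQ₂, mul_add]
    · obtain ⟨W, hW, hxW, m, hm⟩ := hP₃ x hx
      obtain ⟨W', hW', hxW', n, hn⟩ := hQ₃ x hx
      refine ⟨W ⊓ W', inf_le_left.trans hW, ⟨hxW, hxW'⟩, max m n, fun V hV => ?_⟩
      exact ((hm V (hV.trans inf_le_left)).mono (le_max_left _ _)).add
        ((hn V (hV.trans inf_le_right)).mono (le_max_right _ _))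
  neg_mem' := by
    rintro P ⟨hP₁, hP₂, hP₃⟩
    refine ⟨fun V W h g => ?_, fun V c g => ?_, fun x hx => ?_⟩
    · change res h (-(P V g)) = -(P W (res h g))
      rw [map_neg, hP₁ V W h]
    · change -(P V _) = _ * -(P V g)
      rw [hP₂, mul_neg]
    · obtain ⟨W, hW, hxW, m, hm⟩ := hP₃ x hx
      exact ⟨W, hW, hxW, m, fun V hV => (hm V hV).neg⟩
  mul_mem' := by
    rintro P Q ⟨hP₁, hP₂, hP₃⟩ ⟨hQ₁, hQ₂, hQ₃⟩
    refine ⟨fun V W h g => ?_, fun V c g => ?_, fun x hx => ?_⟩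
    · change res h (P V (Q V g)) = P W (Q W (res h g))
      rw [hP₁ V W h, hQ₁ V W h]
    · change P V (Q V _) = _ * P V (Q V g)
      rw [hQ₂, hP₂]
    · obtain ⟨W, hW, hxW, m, hm⟩ := hP₃ x hx
      obtain ⟨W', hW', hxW', n, hn⟩ := hQ₃ x hx
      refine ⟨W ⊓ W', inf_le_left.trans hW, ⟨hxW, hxW'⟩, m + n, fun V hV => ?_⟩
      exact OrderLT.mul rfl (hm V (hV.trans inf_le_left)) (hn V (hV.trans inf_le_right))

/-- Restriction of differential operators to a smaller open set. -/
def diffOpsRes {U U' : X.Opens} (h : U' ≤ U) : diffOps π U →+* diffOps π U' where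
  toFun P := ⟨fun V => P.1 ⟨V.1, V.2.trans h⟩, by
    obtain ⟨P, hP₁, hP₂, hP₃⟩ := P
    refine ⟨fun V W hWV g => hP₁ ⟨V.1, V.2.trans h⟩ ⟨W.1, W.2.trans h⟩ hWV g,
      fun V c g => hP₂ ⟨V.1, V.2.trans h⟩ c g, fun x hx => ?_⟩
    obtain ⟨W, hW, hxW, n, hn⟩ := hP₃ x (h hx)
    exact ⟨W ⊓ U', inf_le_right, ⟨hxW, hx⟩, n, fun V hV => hn V (hV.trans inf_le_left)⟩⟩
  map_one' := rfl
  map_mul' _ _ := rfl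
  map_zero' := rfl
  map_add' _ _ := rfl

/-- `𝒟_X` as a presheaf of rings. -/
def diffOpsPresheaf : TopCat.Presheaf RingCat.{u} X where
  obj U := RingCat.of (diffOps π U.unop)
  map i := RingCat.ofHom (diffOpsRes π (leOfHom i.unop))
  map_id _ := rfl
  map_comp _ _ := rfl

lemma eq_of_res_inf_eq {ι : Type u} (U : ι → X.Opens) {V : X.Opens} (hV : V ≤ iSup U)
    {s t : Γ(X, V)}
    (h : ∀ i, res (inf_le_left : V ⊓ U i ≤ V) s = res (inf_le_left : V ⊓ U i ≤ V) t) : s = t :=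
  X.sheaf.eq_of_locally_eq' (fun i => V ⊓ U i) V (fun i => homOfLE inf_le_left)
    (by rw [← inf_iSup_eq]; exact le_inf le_rfl hV) s t h

/-- Differential operators that agree on overlaps can be glued. -/
lemma diffOps_glue {ι : Type u} (U : ι → X.Opens) (P : ∀ i, diffOps π (U i))
    (hP : ∀ i j, diffOpsRes π (inf_le_left : U i ⊓ U j ≤ U i) (P i) =
      diffOpsRes π (inf_le_right : U i ⊓ U j ≤ U j) (P j)) :
    ∃! Q : diffOps π (iSup U), ∀ i, diffOpsRes π (le_iSup U i) Q = P i := by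
  have hP' : ∀ i j (V : X.Opens) (hi : V ≤ U i) (hj : V ≤ U j),
      (P i).1 ⟨V, hi⟩ = (P j).1 ⟨V, hj⟩ := fun i j V hi hj =>
    congrFun (congrArg Subtype.val (hP i j)) ⟨V, le_inf hi hj⟩
  have key : ∀ (V : X.Opens) (_ : V ≤ iSup U) (g : Γ(X, V)), ∃ s : Γ(X, V), ∀ i,
      res (inf_le_left : V ⊓ U i ≤ V) s =
        (P i).1 ⟨V ⊓ U i, inf_le_right⟩ (res inf_le_left g) := by
    intro V hV g
    obtain ⟨s, hs, -⟩ := X.sheaf.existsUnique_gluing' (fun i => V ⊓ U i) V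
      (fun i => homOfLE inf_le_left) (by rw [← inf_iSup_eq]; exact le_inf le_rfl hV)
      (fun i => (P i).1 ⟨V ⊓ U i, inf_le_right⟩ (res inf_le_left g)) (by
        intro i j
        have h₁ := (P i).2.1 ⟨V ⊓ U i, inf_le_right⟩
          ⟨(V ⊓ U i) ⊓ (V ⊓ U j), inf_le_left.trans inf_le_right⟩ inf_le_left
          (res inf_le_left g)
        have h₂ := (P j).2.1 ⟨V ⊓ U j, inf_le_right⟩
          ⟨(V ⊓ U i) ⊓ (V ⊓ U j), inf_le_right.trans inf_le_right⟩ inf_le_right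
          (res inf_le_left g)
        rw [res_res] at h₁ h₂
        rw [hP' i j _ _ (inf_le_right.trans inf_le_right)] at h₁
        exact h₁.trans h₂.symm)
    exact ⟨s, hs⟩
  choose q hq using key
  have huniq : ∀ (V : X.Opens) (hV : V ≤ iSup U) (g s : Γ(X, V)), (∀ i,
      res (inf_le_left : V ⊓ U i ≤ V) s =
        (P i).1 ⟨V ⊓ U i, inf_le_right⟩ (res inf_le_left g)) → q V hV g = s :=
    fun V hV g s hs => eq_of_res_inf_eq U hV fun i => (hq V hV g i).trans (hs i).symm
  have hloc : ∀ (V : X.Opens) (hV : V ≤ iSup U) (i : ι) (hVi : V ≤ U i) (g : Γ(X, V)),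
      q V hV g = (P i).1 ⟨V, hVi⟩ g := by
    intro V hV i hVi g
    refine huniq V hV g _ fun j => ?_
    rw [← hP' i j (V ⊓ U j) (inf_le_left.trans hVi) inf_le_right]
    exact (P i).2.1 ⟨V, hVi⟩ ⟨V ⊓ U j, inf_le_left.trans hVi⟩ inf_le_left g
  let Q : ∀ V : {V : X.Opens // V ≤ iSup U}, AddMonoid.End Γ(X, V.1) := fun V =>
    { toFun := q V.1 V.2
      map_zero' := huniq _ _ _ _ fun i => by simp
      map_add' := fun a b => huniq _ _ _ _ fun i => by simp [hq] }
  have hQ : Q ∈ diffOps π (iSup U) := by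
    refine ⟨fun V W h g => ?_, fun V c g => ?_, fun x hx => ?_⟩
    · refine (huniq W.1 W.2 _ _ fun i => ?_).symm
      have h₁ := congrArg (res (inf_le_inf_right (U i) h : W.1 ⊓ U i ≤ V.1 ⊓ U i))
        (hq V.1 V.2 g i)
      rw [(P i).2.1 ⟨V.1 ⊓ U i, inf_le_right⟩ ⟨W.1 ⊓ U i, inf_le_right⟩, res_res, res_res] at h₁
      rw [res_res, res_res]
      exact h₁
    · refine huniq V.1 V.2 _ _ fun i => ?_
      rw [map_mul, map_mul, res_scalar, (P i).2.2.1 ⟨V.1 ⊓ U i, inf_le_right⟩]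
      exact congrArg _ (hq V.1 V.2 g i)
    · obtain ⟨i, hi⟩ := Opens.mem_iSup.mp hx
      obtain ⟨W, hW, hxW, n, hn⟩ := (P i).2.2.2 x hi
      refine ⟨W, hW.trans (le_iSup U i), hxW, n, fun V hV => ?_⟩
      have : Q ⟨V, (hV.trans hW).trans (le_iSup U i)⟩ = (P i).1 ⟨V, hV.trans hW⟩ :=
        AddMonoidHom.ext fun g => hloc V _ i (hV.trans hW) g
      rw [this]
      exact hn V hV
  refine ⟨⟨Q, hQ⟩, fun i => ?_, fun R hR => ?_⟩
  · refine Subtype.ext (funext fun V => AddMonoidHom.ext fun g => ?_)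
    exact hloc V.1 _ i V.2 g
  · refine Subtype.ext (funext fun V => AddMonoidHom.ext fun g => ?_)
    refine (huniq V.1 V.2 g _ fun i => ?_).symm
    rw [← hR i]
    exact R.2.1 V ⟨V.1 ⊓ U i, inf_le_left.trans V.2⟩ inf_le_left g

lemma diffOpsPresheaf_isSheaf : (diffOpsPresheaf π).IsSheaf := by
  rw [TopCat.Presheaf.isSheaf_iff_isSheafUniqueGluing]
  intro ι U P hP
  exact diffOps_glue π U P hP

/-- The sheaf of rings `𝒟_X` of Grothendieck differential operators of the `F`-scheme `X`. -/
def diffOpsSheaf : Sheaf (Opens.grothendieckTopology X) RingCat.{u} :=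
  ⟨diffOpsPresheaf π, diffOpsPresheaf_isSheaf π⟩

/-- The ring homomorphism `𝒪_X(U) → 𝒟_X(U)`: a function acts by multiplication. -/
def mulOp (U : X.Opens) : Γ(X, U) →+* diffOps π U where
  toFun a := ⟨fun V => AddMonoid.End.mulLeft (res V.2 a), by
    refine ⟨fun V W h g => ?_, fun V c g => ?_, fun x hx => ?_⟩
    · change res h (res V.2 a * g) = res W.2 a * res h g
      rw [map_mul, res_res]
    · change res V.2 a * (scalar π V.1 c * g) = scalar π V.1 c * (res V.2 a * g)
      ring
    · exact ⟨U, le_rfl, hx, 1, fun V hV => OrderLT.mulLeft _⟩⟩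
  map_one' := Subtype.ext (funext fun V => AddMonoidHom.ext fun g => by
    change res V.2 1 * g = g
    rw [map_one, one_mul])
  map_mul' a b := Subtype.ext (funext fun V => AddMonoidHom.ext fun g => by
    change res V.2 (a * b) * g = res V.2 a * (res V.2 b * g)
    rw [map_mul, mul_assoc])
  map_zero' := Subtype.ext (funext fun V => AddMonoidHom.ext fun g => by
    change res V.2 0 * g = 0
    rw [map_zero, zero_mul])
  map_add' a b := Subtype.ext (funext fun V => AddMonoidHom.ext fun g => by
    change res V.2 (a + b) * g = res V.2 a * g + res V.2 b * g
    rw [map_add, add_mul])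

/-- The morphism of sheaves of rings `𝒪_X → 𝒟_X`. -/
def toDiffOps : X.ringCatSheaf ⟶ diffOpsSheaf π where
  hom :=
    { app := fun U => RingCat.ofHom (mulOp π U.unop)
      naturality := fun U V i => by
        refine RingCat.hom_ext (RingHom.ext fun a => ?_)
        refine Subtype.ext (funext fun W => AddMonoidHom.ext fun g => ?_)
        exact congrArg (· * g)
          (res_res (leOfHom i.unop) W.2 (show Γ(X, U.unop) from a)) }

end Sheaf

/-! ### D-affine varieties -/

section DAffine

variable {F : Type u} [Field F] {X : Scheme.{u}} (π : X ⟶ Spec (CommRingCat.of F))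

/-- The category of sheaves of left `𝒟_X`-modules. -/
abbrev DMod := SheafOfModules.{u} (diffOpsSheaf π)

/-- A sheaf of left `𝒟_X`-modules is `𝒪`-quasicoherent if it is quasicoherent as a sheaf of
`𝒪_X`-modules via `𝒪_X → 𝒟_X`. -/
def OQuasicoherent (M : DMod π) : Prop :=
  ((SheafOfModules.restrictScalars (toDiffOps π)).obj M).IsQuasicoherent

/-- The functor of global sections, with values in the modules over `Γ(X, 𝒟_X)`. -/
noncomputable abbrev globalSections : DMod π ⥤ ModuleCat.{u} (diffOps π (⊤ : X.Opens)) :=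
  SheafOfModules.evaluation (diffOpsSheaf π) (op ⊤)

instance : (globalSections π).Additive where

/-- `X` is D-affine: the functor of global sections is exact on the category of
`𝒪`-quasicoherent left `𝒟_X`-modules, and an object of this category without nonzero global
sections is zero. -/
structure IsDAffine : Prop where
  exact : ∀ S : ShortComplex (DMod π), OQuasicoherent π S.X₁ → OQuasicoherent π S.X₂ →
    OQuasicoherent π S.X₃ → S.ShortExact →
      (S.map (globalSections π)).ShortExact
  isZero : ∀ M : DMod π, OQuasicoherent π M →
    Limits.IsZero ((globalSections π).obj M) → Limits.IsZero M

end DAffine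

/-! ### Projective varieties and contractible divisors -/

section Varieties

variable {F : Type u} [Field F]

attribute [local instance] MvPolynomial.gradedAlgebra

/-- A (possibly reducible) algebraic variety over `F`. -/
structure IsVariety {X : Scheme.{u}} (π : X ⟶ Spec (CommRingCat.of F)) : Prop where
  reduced : IsReduced X
  separated : IsSeparated π
  locallyOfFiniteType : LocallyOfFiniteType π
  quasiCompact : QuasiCompact π

variable (F) in
/-- Projective `n`-space over `F`. -/
noncomputable abbrev projSpace (n : ℕ) : Scheme.{u} :=
  Proj (MvPolynomial.homogeneousSubmodule (Fin (n + 1)) F)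

variable (F) in
/-- The structure morphism of projective `n`-space. -/
noncomputable def projSpaceToSpec (n : ℕ) : projSpace F n ⟶ Spec (CommRingCat.of F) :=
  Proj.toSpecZero (MvPolynomial.homogeneousSubmodule (Fin (n + 1)) F) ≫
    Spec.map (CommRingCat.ofHom
      (algebraMap F (MvPolynomial.homogeneousSubmodule (Fin (n + 1)) F 0)))

/-- `X` is projective over `F`: it is isomorphic to a closed subscheme of some `ℙⁿ` over `F`. -/
def IsProjectiveOver {X : Scheme.{u}} (π : X ⟶ Spec (CommRingCat.of F)) : Prop :=
  ∃ (n : ℕ) (i : X ⟶ projSpace F n), IsClosedImmersion i ∧ i ≫ projSpaceToSpec F n = π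

/-- The closed subscheme of `X` with ideal sheaf `C` is an effective Cartier divisor: locally it
is cut out by one function that is not a zero divisor. -/
def IsEffectiveCartier {X : Scheme.{u}} (C : X.IdealSheafData) : Prop :=
  ∀ x : X, ∃ U : X.affineOpens, x ∈ U.1 ∧
    ∃ s ∈ nonZeroDivisors Γ(X, U.1), C.ideal U = Ideal.span {s}

/-- The closed subscheme of `X` with ideal sheaf `C` is contractible (to finitely many points):
there are a variety `Y` over `F`, an `F`-morphism `f : X ⟶ Y` and an open `V ⊆ Y` with finite
complement such that `C` is, as a set, the preimage of `Y ∖ V`, and `f` restricts to an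
isomorphism from `X ∖ C` to `V`. -/
def IsContractible {X : Scheme.{u}} (π : X ⟶ Spec (CommRingCat.of F)) (C : X.IdealSheafData) :
    Prop :=
  ∃ (Y : Scheme.{u}) (ρ : Y ⟶ Spec (CommRingCat.of F)) (f : X ⟶ Y) (V : Y.Opens),
    IsVariety ρ ∧ f ≫ ρ = π ∧ ((V : Set Y)ᶜ).Finite ∧
      (C.support : Set X) = f ⁻¹' (V : Set Y)ᶜ ∧ IsIso (f ∣_ V)

end Varieties

end DAffinity

universe v v' u'

/-! ### Heights of maximal ideals in finitely generated domains over a field -/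

/-! Suppose `f : X ⟶ Y` contracts `C` to a finite set `T`, and put `U = X ∖ C`. The proof compares
what dimension and D-affinity say about functions on `U`.

Dimension: a function `g` on `U` is constant at every generic point. Otherwise, as `F` is
algebraically closed, `g` has a pole along some valuation ring `O ⊇ F` of the residue field. Since
`X` is universally closed over `F`, `O` has a centre on `X`, hence on `Y`; let `B` be the ring of an
affine neighbourhood of the latter. In the algebra generated by `1/g` over the image of `B`, the
element `1/g` is not a unit. A minimal prime over it has height at most 1, so it is not maximal, and
neither is its contraction to `B`. This gives a non-closed point of `Y`, necessarily outside `T`,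
near which `g` is regular; but it was built to lie where `g` has no regular expression. See
`Ideal.exists_isPrime_not_isMaximal_of_valuationSubring` and `exists_evaluation_eq_scalarAt`. As `X`
is reduced, `g` is then constant on each connected component of `U`.

D-affinity: let `W` be the component of `U` containing the generic point of an irreducible component
of `X` through a point `x` of `C`. Constants extend to `X`, so `𝒪_X → j_* 𝒪_W` is surjective on
global sections, and D-affinity makes it an epimorphism of sheaves (`IsDAffine.exists_res_eq`).
Hence the inverse on `W` of a local equation `s` of `C` extends to some `a` near `x`. Then `a * s -
1` vanishes at the generic point, hence at `x`, where `s` vanishes: a contradiction. A single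
component is used because locally constant functions on a disconnected `U` need not extend. -/

theorem MvPolynomial.height_eq_of_isMaximal {k : Type*} [Field k] (n : ℕ)
    (M : Ideal (MvPolynomial (Fin n) k)) [hM : M.IsMaximal] : M.height = n := by
  induction n with
  | zero =>
    let e : MvPolynomial (Fin 0) k ≃+* k := (MvPolynomial.isEmptyAlgEquiv k (Fin 0)).toRingEquiv
    have hF : IsField (MvPolynomial (Fin 0) k) := e.toMulEquiv.isField (Field.toIsField k)
    let := hF.toField
    rw [Ideal.eq_bot_of_prime M]
    simp
  | succ n ih =>
    let e : MvPolynomial (Fin (n + 1)) k ≃+* Polynomial (MvPolynomial (Fin n) k) :=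
      (MvPolynomial.finSuccEquiv k n).toRingEquiv
    let P : Ideal (Polynomial (MvPolynomial (Fin n) k)) := M.comap e.symm
    have hP : P.IsMaximal := Ideal.comap_isMaximal_of_equiv e.symm
    -- Polynomial rings over a field are Jacobson, so maximal ideals contract to maximal ideals when
    -- one variable is dropped.
    have hp : (P.under (MvPolynomial (Fin n) k)).IsMaximal :=
      Polynomial.isMaximal_comap_C_of_isJacobsonRing P
    have h₁ : P.height = M.height := RingEquiv.height_comap e.symm M
    have : P.LiesOver (P.under (MvPolynomial (Fin n) k)) := ⟨rfl⟩
    rw [← h₁, Polynomial.height_eq_height_add_one (P.under (MvPolynomial (Fin n) k)) P, ih]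
    norm_cast

/-- Maximal ideals in an integral extension of a polynomial ring in `n` variables have height at
least `n`. -/
theorem Ideal.le_height_of_isIntegral_mvPolynomial {k B : Type*} [Field k] [CommRing B]
    [IsDomain B] [IsNoetherianRing B] {n : ℕ} (f : MvPolynomial (Fin n) k →+* B)
    (hf : Function.Injective f) (hint : f.IsIntegral) (P : Ideal B) [P.IsMaximal] :
    (n : ℕ∞) ≤ P.height := by
  algebraize [f]
  have : FaithfulSMul (MvPolynomial (Fin n) k) B :=
    (faithfulSMul_iff_algebraMap_injective _ _).2 hf
  have : Algebra.IsIntegral (MvPolynomial (Fin n) k) B := ⟨hint⟩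
  have hp : (P.under (MvPolynomial (Fin n) k)).IsMaximal :=
    Ideal.IsMaximal.under (MvPolynomial (Fin n) k) P
  -- Going down holds because polynomial rings are integrally closed.
  rw [Ideal.height_eq_height_add_of_liesOver_of_hasGoingDown
    (P.under (MvPolynomial (Fin n) k)) P, MvPolynomial.height_eq_of_isMaximal]
  exact le_self_add

/-- Incomparability: contraction along an integral map preserves strict inclusions of primes.
Injectivity is not needed. -/
theorem ringKrullDim_le_of_isIntegral {R S : Type*} [CommRing R] [CommRing S] (f : R →+* S)
    (hint : f.IsIntegral) : ringKrullDim S ≤ ringKrullDim R := by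
  algebraize [f]
  have : Algebra.IsIntegral R S := ⟨hint⟩
  refine Order.krullDim_le_of_strictMono (fun P => PrimeSpectrum.comap (algebraMap R S) P) ?_
  intro P Q hPQ
  exact Ideal.comap_lt_comap_of_integral_mem_sdiff (R := R) (S := S) hPQ.le
    (Set.exists_of_ssubset hPQ).choose_spec (Algebra.IsIntegral.isIntegral _)

/-- If a field `K` contains a finitely generated `k`-algebra of dimension at least `2`, then in
every finitely generated `k`-algebra with fraction field `K` the maximal ideals have height at
least `2`. -/
theorem Ideal.two_le_height_of_isMaximal {k K A B : Type u} [Field k] [Field K] [Algebra k K]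
    [CommRing A] [Algebra k A] [Algebra.FiniteType k A] (i : A →ₐ[k] K)
    (hi : Function.Injective i) (hA : 2 ≤ ringKrullDim A)
    [CommRing B] [Algebra k B] [Algebra.FiniteType k B] (j : B →ₐ[k] K)
    (hj : Function.Injective j) (hfrac : ∀ u : K, ∃ a b : B, j b ≠ 0 ∧ u * j b = j a)
    (P : Ideal B) [P.IsMaximal] : 2 ≤ P.height := by
  have : IsDomain A := hi.isDomain i.toRingHom
  have : IsDomain B := hj.isDomain j.toRingHom
  have : IsNoetherianRing B := Algebra.FiniteType.isNoetherianRing k B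
  -- Noether normalization of both algebras; transcendence degree then links the numbers of
  -- variables: `2 ≤ r ≤ trdeg K ≤ s`.
  obtain ⟨r, f, hf, hfint⟩ := exists_integral_inj_algHom_of_fg k A
  obtain ⟨s, g, hg, hgint⟩ := exists_integral_inj_algHom_of_fg k B
  have hr : 2 ≤ r := by
    have h := hA.trans (ringKrullDim_le_of_isIntegral f.toRingHom hfint)
    rw [MvPolynomial.ringKrullDim_of_isNoetherianRing] at h
    simp only [ringKrullDim_eq_zero_of_field, Nat.card_eq_fintype_card, Fintype.card_fin,
      zero_add] at h
    exact_mod_cast h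
  have hrK : (r : Cardinal) ≤ Algebra.trdeg k K := by
    have h := trdeg_le_of_injective (i.comp f) (hi.comp hf)
    rw [MvPolynomial.trdeg_of_isDomain] at h
    simpa using h
  have hKs : Algebra.trdeg k K ≤ s := by
    let φ := j.comp g
    let : Algebra (MvPolynomial (Fin s) k) K := φ.toRingHom.toAlgebra
    have : IsScalarTower k (MvPolynomial (Fin s) k) K :=
      IsScalarTower.of_algebraMap_eq fun x => (φ.commutes x).symm
    have hinj : Function.Injective (algebraMap (MvPolynomial (Fin s) k) K) := hj.comp hg
    have : FaithfulSMul (MvPolynomial (Fin s) k) K :=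
      (faithfulSMul_iff_algebraMap_injective _ _).2 hinj
    have hjint : ∀ b : B, IsAlgebraic (MvPolynomial (Fin s) k) (j b) := by
      intro b
      obtain ⟨p, hp, hp'⟩ := hgint b
      refine IsIntegral.isAlgebraic ⟨p, hp, ?_⟩
      have := congrArg j hp'
      rw [map_zero] at this
      rw [← this]
      exact (Polynomial.hom_eval₂ p g.toRingHom j.toRingHom b).symm
    have : Algebra.IsAlgebraic (MvPolynomial (Fin s) k) K := by
      refine ⟨fun u => ?_⟩
      obtain ⟨a, b, hb, hu⟩ := hfrac u
      rw [eq_div_of_mul_eq hb hu, div_eq_mul_inv]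
      exact (hjint a).mul (hjint b).inv
    have h := trdeg_add_eq k (MvPolynomial (Fin s) k) (A := K)
    rw [trdeg_eq_zero (R := MvPolynomial (Fin s) k) (A := K), add_zero,
      MvPolynomial.trdeg_of_isDomain] at h
    rw [← h]
    simp
  have hs : 2 ≤ s := hr.trans (by exact_mod_cast hrK.trans hKs)
  exact le_trans (by exact_mod_cast hs) (Ideal.le_height_of_isIntegral_mvPolynomial g.toRingHom
    hg hgint P)

/-! ### Exactness of the restriction of scalars for sheaves of modules -/

namespace CategoryTheory

open Limits

/-- If `L` is left adjoint to a fully faithful functor and `L ⋙ G` preserves colimits of shape `K`,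
then so does `G`. -/
theorem Adjunction.preservesColimitsOfShape_of_comp {C D E : Type*} [Category* C] [Category* D]
    [Category* E] {L : C ⥤ D} {R : D ⥤ C} (adj : L ⊣ R) [R.Full] [R.Faithful] (G : D ⥤ E)
    (K : Type*) [Category* K] [HasColimitsOfShape K C] [PreservesColimitsOfShape K (L ⋙ G)] :
    PreservesColimitsOfShape K G where
  preservesColimit {F} := by
    have : PreservesColimitsOfShape K L := adj.leftAdjoint_preservesColimits.preservesColimitsOfShape
    -- The counit is invertible, so every diagram in `D` comes from `C` through `L`.
    let e : (F ⋙ R) ⋙ L ≅ F := Functor.isoWhiskerLeft F (asIso adj.counit)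
    have : PreservesColimit ((F ⋙ R) ⋙ L) G :=
      preservesColimit_of_preserves_colimit_cocone
        (isColimitOfPreserves L (colimit.isColimit (F ⋙ R)))
        (isColimitOfPreserves (L ⋙ G) (colimit.isColimit (F ⋙ R)))
    exact preservesColimit_of_iso_diagram G e

end CategoryTheory

namespace SheafOfModules

open Limits

variable {C : Type u'} [Category.{v'} C] {J : GrothendieckTopology C}
  [HasSheafify J AddCommGrpCat.{u}] [J.WEqualsLocallyBijective AddCommGrpCat.{u}]

/-- Sheafifying a presheaf of modules and then forgetting scalars is sheafifying the underlying
abelian presheaf, which is exact. -/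
instance preservesFiniteColimits_toSheaf (R : Sheaf J RingCat.{u}) :
    PreservesFiniteColimits (toSheaf.{u} R) where
  preservesFiniteColimits K _ _ := by
    let adj := PresheafOfModules.sheafificationAdjunction.{u} (𝟙 R.obj)
    have : PreservesColimitsOfShape K
        (PresheafOfModules.sheafification.{u} (𝟙 R.obj) ⋙ toSheaf.{u} R) :=
      inferInstanceAs (PreservesColimitsOfShape K
        (PresheafOfModules.toPresheaf.{u} R.obj ⋙ presheafToSheaf J AddCommGrpCat))
    exact adj.preservesColimitsOfShape_of_comp (toSheaf.{u} R) K

variable {R R' : Sheaf J RingCat.{u}} (α : R ⟶ R')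

/-- Restriction of scalars leaves the underlying abelian sheaf unchanged, and the forgetful functor
both preserves and reflects finite colimits. -/
instance preservesFiniteColimits_restrictScalars :
    PreservesFiniteColimits (restrictScalars.{u} α) where
  preservesFiniteColimits K _ _ := by
    have : PreservesColimitsOfShape K (restrictScalars.{u} α ⋙ toSheaf.{u} R) :=
      inferInstanceAs (PreservesColimitsOfShape K (toSheaf.{u} R'))
    have : ReflectsColimitsOfShape K (toSheaf.{u} R) :=
      reflectsColimitsOfShape_of_reflectsIsomorphisms
    exact preservesColimitsOfShape_of_reflects_of_preserves (restrictScalars.{u} α) (toSheaf.{u} R)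

/-- An epimorphism of sheaves of modules is locally surjective. -/
theorem isLocallySurjective_of_epi {M N : SheafOfModules.{u} R} (f : M ⟶ N) [Epi f] :
    Sheaf.IsLocallySurjective ((toSheaf.{u} R).map f) := by
  rw [Sheaf.isLocallySurjective_iff_epi']
  infer_instance

end SheafOfModules

/-! ### Quasicoherence of sheaves of modules on schemes -/

namespace AlgebraicGeometry.Scheme.Modules

open Limits

/-- Transport of a presentation along an isomorphism. -/
noncomputable def presentationOfIso {X : Scheme.{u}} {M N : X.Modules} (e : M ≅ N)
    (p : M.Presentation) : N.Presentation :=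
  @SheafOfModules.Presentation.ofIsIso.{u} _ _ _ X.ringCatSheaf _ _ M N e.hom
    (show IsIso (C := X.Modules) e.hom from inferInstance) p

theorem nonempty_presentation_of_isQuasicoherent_spec {R : CommRingCat.{u}} (M : (Spec R).Modules)
    [hM : M.IsQuasicoherent] : Nonempty M.Presentation := by
  have h : IsIso M.fromTildeΓ := isIso_fromTildeΓ_of_isQuasicoherent M
  exact ⟨presentationOfIso (@asIso _ _ _ _ M.fromTildeΓ h)
    (presentationTilde _ .univ (by simp) _ (Submodule.span_eq _))⟩

theorem nonempty_presentation_restrict_of_isAffineOpen {X : Scheme.{u}} (M : X.Modules)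
    {U : X.Opens} (hU : IsAffineOpen U) (hq : (M.restrict hU.fromSpec).IsQuasicoherent) :
    Nonempty (M.restrict U.ι).Presentation := by
  obtain ⟨p⟩ := nonempty_presentation_of_isQuasicoherent_spec (M.restrict hU.fromSpec)
  let i : restrictFunctor hU.fromSpec ⋙ restrictFunctor hU.isoSpec.hom ≅ restrictFunctor U.ι :=
    (restrictFunctorComp _ _).symm ≪≫ restrictFunctorCongr hU.isoSpec_hom_fromSpec
  exact ⟨presentationOfIso (i.app M)
    (presentationRestrict hU.isoSpec.hom p)⟩

/-- Quasicoherence is defined on the slice site over `U`, the affine theory lives on the scheme `U`;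
`overEquiv` carries presentations across. -/
theorem nonempty_presentation_over {X : Scheme.{u}} (M : X.Modules) (U : X.Opens)
    (p : (M.restrict U.ι).Presentation) :
    Nonempty (SheafOfModules.over (R := X.ringCatSheaf) M U).Presentation := by
  let G : SheafOfModules.{u} (U : Scheme.{u}).ringCatSheaf ⥤
      SheafOfModules.{u} (X.ringCatSheaf.over U) := (overEquiv U).inverse
  have : PreservesColimitsOfSize.{u, u} G :=
    (inferInstance : PreservesColimitsOfSize.{u, u} (overEquiv U).inverse)
  let q : SheafOfModules.Presentation (R := (U : Scheme.{u}).ringCatSheaf)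
      ((overEquiv U).functor.obj (SheafOfModules.over (R := X.ringCatSheaf) M U)) :=
    presentationOfIso ((overFunctorEquiv U).app M).symm p
  let η : SheafOfModules.unit (X.ringCatSheaf.over U) ≅
      G.obj (SheafOfModules.unit (U : Scheme.{u}).ringCatSheaf) :=
    (overEquiv U).unitIso.app _
  exact ⟨SheafOfModules.Presentation.ofIsIso.{u, u, u} ((overEquiv U).unitIso.app
    (SheafOfModules.over (R := X.ringCatSheaf) M U)).inv (q.map G η)⟩

/-- A sheaf of modules on a scheme is quasicoherent if its restrictions to the members of an affine
open cover are. -/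
theorem isQuasicoherent_of_affine_restrict {X : Scheme.{u}} (M : X.Modules)
    (H : ∀ x : X, ∃ (U : X.Opens) (hU : IsAffineOpen U), x ∈ U ∧
      (M.restrict hU.fromSpec).IsQuasicoherent) : M.IsQuasicoherent := by
  choose U hU hxU hq using H
  have hpres : ∀ x, Nonempty (SheafOfModules.over (R := X.ringCatSheaf) M (U x)).Presentation :=
    fun x => nonempty_presentation_over M (U x)
      (nonempty_presentation_restrict_of_isAffineOpen M (hU x) (hq x)).some
  let q : SheafOfModules.QuasicoherentData.{u} (R := X.ringCatSheaf) M :=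
    { I := X
      X := U
      coversTop := by
        rw [Opens.coversTop_iff, IsOpenCover, eq_top_iff]
        intro x _
        exact Opens.mem_iSup.2 ⟨x, hxU x⟩
      presentation := fun x => (hpres x).some }
  exact q.isQuasicoherent

/-- The counit identifies `f` with the tilde of its map on global sections, and tilde preserves
cokernels. -/
theorem isQuasicoherent_cokernel_spec {R : CommRingCat.{u}} {M N : (Spec R).Modules} (f : M ⟶ N)
    (hM : M.IsQuasicoherent) (hN : N.IsQuasicoherent) : (cokernel f).IsQuasicoherent := by
  have h₁ : IsIso M.fromTildeΓ := isIso_fromTildeΓ_of_isQuasicoherent M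
  have h₂ : IsIso N.fromTildeΓ := isIso_fromTildeΓ_of_isQuasicoherent N
  have hsq : (tilde.functor R).map (moduleSpecΓFunctor.map f) ≫ N.fromTildeΓ =
      M.fromTildeΓ ≫ f :=
    (tilde.adjunction (R := R)).counit.naturality f
  let e : (tilde.functor R).obj (cokernel (moduleSpecΓFunctor.map f)) ≅ cokernel f :=
    PreservesCokernel.iso (tilde.functor R) _ ≪≫
      cokernel.mapIso _ _ (@asIso _ _ _ _ M.fromTildeΓ h₁)
        (@asIso _ _ _ _ N.fromTildeΓ h₂) hsq
  exact (SheafOfModules.isQuasicoherent (Spec R).ringCatSheaf).prop_of_iso e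
    (inferInstanceAs ((tilde.functor R).obj (cokernel (moduleSpecΓFunctor.map f))).IsQuasicoherent)

theorem isQuasicoherent_cokernel {X : Scheme.{u}} {M N : X.Modules} (f : M ⟶ N)
    (hM : M.IsQuasicoherent) (hN : N.IsQuasicoherent) : (cokernel f).IsQuasicoherent := by
  refine isQuasicoherent_of_affine_restrict _ fun x => ?_
  obtain ⟨U, hU, hx, -⟩ := exists_isAffineOpen_mem_and_subset (X := X) (U := ⊤) (x := x) trivial
  refine ⟨U, hU, hx, ?_⟩
  have : (restrictFunctor hU.fromSpec).PreservesZeroMorphisms :=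
    Functor.preservesZeroMorphisms_of_isLeftAdjoint _
  have := isQuasicoherent_cokernel_spec ((restrictFunctor hU.fromSpec).map f)
    (isQuasicoherent_restrictFunctor hU.fromSpec M) (isQuasicoherent_restrictFunctor hU.fromSpec N)
  exact (SheafOfModules.isQuasicoherent (Spec Γ(X, U)).ringCatSheaf).prop_of_iso
    (PreservesCokernel.iso (restrictFunctor hU.fromSpec) f).symm this

end AlgebraicGeometry.Scheme.Modules

/-! ### Quasicoherence from localization of sections -/

namespace AlgebraicGeometry.Scheme.Modules

theorem appIso_fromSpec_inv_ΓSpecIso_inv {X : Scheme.{u}} {U : X.Opens} (hU : IsAffineOpen U)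
    (V : (Spec Γ(X, U)).Opens) (h : hU.fromSpec ''ᵁ V ≤ U) (r : Γ(X, U)) :
    (hU.fromSpec.appIso V).inv ((Spec Γ(X, U)).presheaf.map V.leTop.op
      ((Scheme.ΓSpecIso Γ(X, U)).inv r)) = X.presheaf.map (homOfLE h).op r := by
  suffices H : (Scheme.ΓSpecIso Γ(X, U)).inv ≫ (Spec Γ(X, U)).presheaf.map V.leTop.op ≫
      (hU.fromSpec.appIso V).inv = X.presheaf.map (homOfLE h).op from congr($(H) r)
  rw [← Category.assoc, Iso.comp_inv_eq, Scheme.Hom.appIso_hom', Scheme.Hom.map_appLE,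
    Scheme.Hom.appLE, hU.fromSpec_app_self, Category.assoc, ← Functor.map_comp]
  rfl

/-- A sheaf of modules is quasicoherent on an affine open set `U` if its sections over the basic
open sets `D(f)` are the localizations of its sections over `U`. -/
theorem isQuasicoherent_restrict_fromSpec {X : Scheme.{u}} (M : X.Modules) {U : X.Opens}
    (hU : IsAffineOpen U)
    (hsurj : ∀ (f : Γ(X, U)) (s : Γ(M, X.basicOpen f)), ∃ (n : ℕ) (t : Γ(M, U)),
      M.presheaf.map (homOfLE (X.basicOpen_le f)).op t =
        X.presheaf.map (homOfLE (X.basicOpen_le f)).op (f ^ n) • s)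
    (hinj : ∀ (f : Γ(X, U)) (t : Γ(M, U)),
      M.presheaf.map (homOfLE (X.basicOpen_le f)).op t = 0 → ∃ n : ℕ, f ^ n • t = 0) :
    (M.restrict hU.fromSpec).IsQuasicoherent := by
  rw [isQuasicoherent_iff_isIso_fromTildeΓ, isIso_fromTildeΓ_iff_isLocalizing]
  -- The images of `⊤` and `D(f)` under `fromSpec` equal `U` and `X.basicOpen f` only
  -- propositionally, hence the variables `U'` and `V'`.
  have hsurj' : ∀ (f : Γ(X, U)) (U' V' : X.Opens) (h₁ : U' = U) (h₂ : V' = X.basicOpen f)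
      (h₃ : V' ≤ U') (s : Γ(M, V')), ∃ (n : ℕ) (t : Γ(M, U')), M.presheaf.map (homOfLE h₃).op t =
        X.presheaf.map (homOfLE (h₃.trans h₁.le)).op (f ^ n) • s := by
    rintro f _ _ rfl rfl _ s
    exact hsurj f s
  have hinj' : ∀ (f : Γ(X, U)) (U' V' : X.Opens) (h₁ : U' = U) (h₂ : V' = X.basicOpen f)
      (h₃ : V' ≤ U') (t : Γ(M, U')), M.presheaf.map (homOfLE h₃).op t = 0 →
        ∃ n : ℕ, X.presheaf.map (homOfLE h₁.le).op (f ^ n) • t = 0 := by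
    rintro f _ _ rfl rfl _ s h
    obtain ⟨n, hn⟩ := hinj f s h
    refine ⟨n, ?_⟩
    rw [← hn]
    exact congrArg (· • s) congr($(X.presheaf.map_id _) (f ^ n))
  intro f
  refine IsLocalizedModule.Away.mk_of_addCommGroup ?_ ?_ ?_
  · exact isUnit_algebraMap_end_of_le_basicOpen (M := M.restrict hU.fromSpec) f le_rfl
  · intro s
    obtain ⟨n, t, ht⟩ := hsurj' f (hU.fromSpec ''ᵁ ⊤) (hU.fromSpec ''ᵁ PrimeSpectrum.basicOpen f)
      (by simp) (hU.fromSpec_image_basicOpen f) (Scheme.Hom.image_mono _ le_top) s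
    refine ⟨n, t, Eq.trans ?_ ht.symm⟩
    exact congrArg (fun r => (M.smul r).hom s) (appIso_fromSpec_inv_ΓSpecIso_inv hU
      (PrimeSpectrum.basicOpen f) (by simp [hU.fromSpec_image_basicOpen, X.basicOpen_le]) (f ^ n))
  · intro t ht
    obtain ⟨n, hn⟩ := hinj' f (hU.fromSpec ''ᵁ ⊤) (hU.fromSpec ''ᵁ PrimeSpectrum.basicOpen f)
      (by simp) (hU.fromSpec_image_basicOpen f) (Scheme.Hom.image_mono _ le_top) t ht
    refine ⟨n, Eq.trans ?_ hn⟩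
    exact congrArg (fun r => (M.smul r).hom t) (appIso_fromSpec_inv_ΓSpecIso_inv hU ⊤ (by simp) (f ^ n))

end AlgebraicGeometry.Scheme.Modules

namespace DAffinity

/-! ### The direct image of the structure sheaf of an open subscheme as a `𝒟`-module -/

section DirectImage

variable {F : Type u} [Field F] {X : Scheme.{u}} (π : X ⟶ Spec (CommRingCat.of F))

/-- The abelian presheaf `V ↦ 𝒪_X(V ∩ W)`. -/
noncomputable def restrictedPresheaf (W : X.Opens) : (Opens X)ᵒᵖ ⥤ Ab.{u} where
  obj V := AddCommGrpCat.of Γ(X, V.unop ⊓ W)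
  map i := AddCommGrpCat.ofHom (res (inf_le_inf_right W (leOfHom i.unop))).toAddMonoidHom
  map_id V := by
    ext g
    exact congr($(X.presheaf.map_id (op (V.unop ⊓ W))) g)
  map_comp i j := by
    ext g
    exact (res_res _ _ _).symm

lemma restrictedPresheaf_isSheaf (W : X.Opens) :
    TopCat.Presheaf.IsSheaf (X := X.toTopCat) (restrictedPresheaf W) := by
  rw [TopCat.Presheaf.isSheaf_iff_isSheafUniqueGluing]
  intro ι U s hs
  obtain ⟨t, ht, htu⟩ := X.sheaf.existsUnique_gluing' (fun i => U i ⊓ W) (iSup U ⊓ W)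
    (fun i => homOfLE (inf_le_inf_right W (le_iSup U i))) (by rw [← iSup_inf_eq]) s (by
      intro i j
      have h : (U i ⊓ W) ⊓ (U j ⊓ W) ≤ (U i ⊓ U j) ⊓ W :=
        le_inf (inf_le_inf inf_le_left inf_le_left) (inf_le_left.trans inf_le_right)
      have h₁ := congrArg (res h) (hs i j)
      exact ((res_res (X := X) (inf_le_inf_right W inf_le_left) h (s i)).symm.trans h₁).trans
        (res_res (X := X) (inf_le_inf_right W inf_le_right) h (s j)))
  exact ⟨t, fun i => ht i, fun t' ht' => htu t' fun i => ht' i⟩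

instance (W : X.Opens) (V : (Opens X)ᵒᵖ) :
    Module ((diffOpsSheaf π).obj.obj V) ((restrictedPresheaf W).obj V) where
  smul P g := (show diffOps π V.unop from P).1 ⟨V.unop ⊓ W, inf_le_left⟩ g
  one_smul _ := rfl
  mul_smul _ _ _ := rfl
  smul_zero P := map_zero ((show diffOps π V.unop from P).1 ⟨V.unop ⊓ W, inf_le_left⟩)
  smul_add P := map_add ((show diffOps π V.unop from P).1 ⟨V.unop ⊓ W, inf_le_left⟩)
  add_smul _ _ _ := rfl
  zero_smul _ := rfl

/-- The direct image of `𝒪_W` under the inclusion of an open subscheme `W` of `X`, as a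
`𝒟_X`-module: a differential operator on `V` acts on `𝒪_X(V ∩ W)`. -/
noncomputable def directImage (W : X.Opens) : DMod π where
  val := PresheafOfModules.ofPresheaf (R := (diffOpsSheaf π).obj) (restrictedPresheaf W)
    (fun U V i P g => P.2.1 ⟨U.unop ⊓ W, inf_le_left⟩
      ⟨V.unop ⊓ W, inf_le_left.trans (leOfHom i.unop)⟩ (inf_le_inf_right W (leOfHom i.unop)) g)
  isSheaf := restrictedPresheaf_isSheaf W

/-- The restriction of functions, as a morphism of `𝒟_X`-modules. -/
noncomputable def directImageMap {W W' : X.Opens} (h : W ≤ W') :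
    directImage π W' ⟶ directImage π W where
  val := PresheafOfModules.homMk
    { app := fun V => AddCommGrpCat.ofHom (res (inf_le_inf_left V.unop h)).toAddMonoidHom
      naturality := fun U V i => by
        ext g
        exact (res_res (X := X) _ _ _).trans (res_res (X := X) _ _ _).symm }
    (fun V P g => P.2.1 ⟨V.unop ⊓ W', inf_le_left⟩ ⟨V.unop ⊓ W, inf_le_left⟩
      (inf_le_inf_left V.unop h) g)

end DirectImage

end DAffinity

/-! ### Kernels: left exactness and localization of sections -/

namespace SheafOfModules

open Limits

variable {C : Type u'} [Category.{v'} C] {J : GrothendieckTopology C}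
  [HasSheafify J AddCommGrpCat.{u}] [J.WEqualsLocallyBijective AddCommGrpCat.{u}]
  {R R' : Sheaf J RingCat.{u}} (α : R ⟶ R')

instance preservesFiniteLimits_restrictScalars :
    PreservesFiniteLimits (restrictScalars.{u} α) where
  preservesFiniteLimits K _ _ := by
    have : PreservesLimitsOfShape K (restrictScalars.{u} α ⋙ toSheaf.{u} R) :=
      inferInstanceAs (PreservesLimitsOfShape K (toSheaf.{u} R'))
    have : ReflectsLimitsOfShape K (toSheaf.{u} R) :=
      reflectsLimitsOfShape_of_reflectsIsomorphisms
    exact preservesLimitsOfShape_of_reflects_of_preserves (restrictScalars.{u} α) (toSheaf.{u} R)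

end SheafOfModules

namespace AlgebraicGeometry.Scheme.Modules

open Limits

/-- The sections of `M` over the basic open subsets `D(f)` of `U` are the localizations of the
sections over `U`. -/
structure IsLocalizingOn {X : Scheme.{u}} (M : X.Modules) (U : X.Opens) : Prop where
  surj : ∀ (f : Γ(X, U)) (s : Γ(M, X.basicOpen f)), ∃ (n : ℕ) (t : Γ(M, U)),
    M.presheaf.map (homOfLE (X.basicOpen_le f)).op t =
      X.presheaf.map (homOfLE (X.basicOpen_le f)).op (f ^ n) • s
  inj : ∀ (f : Γ(X, U)) (t : Γ(M, U)),
    M.presheaf.map (homOfLE (X.basicOpen_le f)).op t = 0 → ∃ n : ℕ, f ^ n • t = 0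

theorem isQuasicoherent_of_isLocalizingOn {X : Scheme.{u}} (M : X.Modules)
    (h : ∀ U : X.Opens, IsAffineOpen U → M.IsLocalizingOn U) : M.IsQuasicoherent := by
  refine isQuasicoherent_of_affine_restrict _ fun x => ?_
  obtain ⟨U, hU, hx, -⟩ := exists_isAffineOpen_mem_and_subset (X := X) (U := ⊤) (x := x) trivial
  exact ⟨U, hU, hx, isQuasicoherent_restrict_fromSpec M hU (h U hU).surj (h U hU).inj⟩

/-- The functor of sections over an open set. -/
noncomputable abbrev sectionsFunctor {X : Scheme.{u}} (U : X.Opens) : X.Modules ⥤ Ab.{u} :=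
  toPresheaf X ⋙ (CategoryTheory.evaluation _ _).obj (op U)

instance {X : Scheme.{u}} (U : X.Opens) : PreservesFiniteLimits (sectionsFunctor U) :=
  have : PreservesFiniteLimits (toPresheaf X) := PreservesLimits.preservesFiniteLimits _
  have : PreservesFiniteLimits ((CategoryTheory.evaluation (Opens X)ᵒᵖ Ab.{u}).obj (op U)) :=
    PreservesLimits.preservesFiniteLimits _
  comp_preservesFiniteLimits _ _

instance {X : Scheme.{u}} (U : X.Opens) : (sectionsFunctor U).PreservesZeroMorphisms :=
  ⟨fun _ _ => rfl⟩

theorem kernel_ι_app_injective {X : Scheme.{u}} {M N : X.Modules} (f : M ⟶ N) (U : X.Opens) :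
    Function.Injective ((kernel.ι f).app U) := by
  have : Mono ((sectionsFunctor U).map (kernel.ι f)) := inferInstance
  exact (AddCommGrpCat.mono_iff_injective _).1 this

theorem exists_kernel_ι_app_eq {X : Scheme.{u}} {M N : X.Modules} (f : M ⟶ N) (U : X.Opens)
    (t : Γ(M, U)) (ht : f.app U t = 0) : ∃ s, (kernel.ι f).app U s = t := by
  have h := (ShortComplex.exact_kernel f).map_of_mono_of_preservesKernel (sectionsFunctor U)
    inferInstance inferInstance
  exact (ShortComplex.ab_exact_iff _).1 h t ht

theorem Hom.app_naturality_apply {X : Scheme.{u}} {M N : X.Modules} (f : M ⟶ N) {U V : X.Opens}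
    (h : V ≤ U) (t : Γ(M, U)) : N.presheaf.map (homOfLE h).op (f.app U t) =
      f.app V (M.presheaf.map (homOfLE h).op t) :=
  (congr($(f.mapPresheaf.naturality (homOfLE h).op) t)).symm

/-- A power `a ^ n` extends the section to one of `M`; its image in `N` dies on `D(a)`, so a further
power `a ^ m` moves the extension into the kernel. -/
theorem IsLocalizingOn.kernel {X : Scheme.{u}} {M N : X.Modules} (f : M ⟶ N) {U : X.Opens}
    (hM : M.IsLocalizingOn U) (hN : N.IsLocalizingOn U) : (kernel f).IsLocalizingOn U where
  surj a s := by
    obtain ⟨n, t, ht⟩ := hM.surj a ((kernel.ι f).app _ s)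
    have h₀ : ∀ s, f.app (X.basicOpen a) ((kernel.ι f).app _ s) = 0 := fun s =>
      congr(($(kernel.condition f)).app _ s)
    obtain ⟨m, hm⟩ := hN.inj a (f.app U t) (by
      rw [Hom.app_naturality_apply, ht, Hom.app_smul, h₀, smul_zero])
    obtain ⟨t', ht'⟩ := exists_kernel_ι_app_eq f U (a ^ m • t) (by rw [Hom.app_smul, hm])
    refine ⟨m + n, t', kernel_ι_app_injective f _ ?_⟩
    rw [← Hom.app_naturality_apply, ht', map_smul, ht, Hom.app_smul, smul_smul, pow_add, map_mul]
  inj a t ht := by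
    obtain ⟨n, hn⟩ := hM.inj a ((kernel.ι f).app U t) (by
      rw [Hom.app_naturality_apply, ht, map_zero])
    refine ⟨n, kernel_ι_app_injective f _ ?_⟩
    rw [Hom.app_smul, hn, map_zero]

end AlgebraicGeometry.Scheme.Modules

/-! ### Quasicoherence of the `𝒟`-modules involved -/

namespace DAffinity

section Quasicoherence

open Limits Scheme.Modules

variable {F : Type u} [Field F] {X : Scheme.{u}} (π : X ⟶ Spec (CommRingCat.of F))

/-- The underlying `𝒪_X`-module of a `𝒟_X`-module. -/
noncomputable abbrev toModules : DMod π ⥤ X.Modules :=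
  SheafOfModules.restrictScalars (toDiffOps π)

theorem OQuasicoherent.cokernel {M N : DMod π} (f : M ⟶ N) (hM : OQuasicoherent π M)
    (hN : OQuasicoherent π N) : OQuasicoherent π (cokernel f) := by
  have h := isQuasicoherent_cokernel (X := X) ((toModules π).map f) hM hN
  have : (SheafOfModules.restrictScalars (toDiffOps π)).PreservesZeroMorphisms :=
    ⟨fun _ _ => rfl⟩
  have := SheafOfModules.preservesFiniteColimits_restrictScalars (toDiffOps π)
  exact (SheafOfModules.isQuasicoherent X.ringCatSheaf).prop_of_iso
    (PreservesCokernel.iso (SheafOfModules.restrictScalars (toDiffOps π)) f).symm h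

/-- Localization on affine opens is assumed instead of quasicoherence because it passes to kernels
by a computation with sections. -/
theorem oQuasicoherent_kernel {M N : DMod π} (f : M ⟶ N)
    (hM : ∀ U : X.Opens, IsAffineOpen U → IsLocalizingOn ((toModules π).obj M) U)
    (hN : ∀ U : X.Opens, IsAffineOpen U → IsLocalizingOn ((toModules π).obj N) U) :
    OQuasicoherent π (kernel f) := by
  have h := isQuasicoherent_of_isLocalizingOn (kernel (C := X.Modules) ((toModules π).map f))
    fun U hU => .kernel _ (hM U hU) (hN U hU)
  have : (SheafOfModules.restrictScalars (toDiffOps π)).PreservesZeroMorphisms :=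
    ⟨fun _ _ => rfl⟩
  have := SheafOfModules.preservesFiniteLimits_restrictScalars (toDiffOps π)
  exact (SheafOfModules.isQuasicoherent X.ringCatSheaf).prop_of_iso
    (PreservesKernel.iso (SheafOfModules.restrictScalars (toDiffOps π)) f).symm h

/-- This is the lemma on sections over basic opens of quasi-compact quasi-separated sets, applied to
`U ⊓ W`, since `D(f) ⊓ W` is the basic open of `f` restricted to `U ⊓ W`. -/
theorem isLocalizingOn_directImage (W U : X.Opens) (hc : IsCompact (U ⊓ W : X.Opens).1)
    (hs : IsQuasiSeparated (U ⊓ W : X.Opens).1) :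
    IsLocalizingOn ((toModules π).obj (directImage π W)) U := by
  have key : ∀ (f : Γ(X, U)) (V : X.Opens) (hV : V = X.basicOpen (res inf_le_left f : Γ(X, U ⊓ W)))
      (hVU : V ≤ U) (hVW : V ≤ U ⊓ W),
      (∀ s : Γ(X, V), ∃ (n : ℕ) (t : Γ(X, U ⊓ W)), res hVW t = res hVU (f ^ n) * s) ∧
      (∀ t : Γ(X, U ⊓ W), res hVW t = 0 → ∃ n : ℕ, res inf_le_left (f ^ n) * t = 0) := by
    rintro f _ rfl hVU hVW
    refine ⟨fun s => ?_, fun t ht => ?_⟩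
    · obtain ⟨n, t, ht⟩ := exists_eq_pow_mul_of_isCompact_of_isQuasiSeparated X (U ⊓ W) hc hs
        (res inf_le_left f : Γ(X, U ⊓ W)) s
      refine ⟨n, t, ?_⟩
      rw [map_pow, ← res_res inf_le_left hVW]
      exact ht
    · obtain ⟨n, hn⟩ := exists_pow_mul_eq_zero_of_res_basicOpen_eq_zero_of_isCompact X hc
        t (res inf_le_left f : Γ(X, U ⊓ W)) ht
      exact ⟨n, by rwa [map_pow]⟩
  have hV : ∀ f : Γ(X, U), X.basicOpen f ⊓ W = X.basicOpen (res inf_le_left f : Γ(X, U ⊓ W)) := by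
    intro f
    refine Eq.trans ?_ (X.basicOpen_res f (homOfLE inf_le_left).op).symm
    ext x
    exact ⟨fun h => ⟨⟨X.basicOpen_le f h.1, h.2⟩, h.1⟩, fun h => ⟨h.2, h.1.2⟩⟩
  constructor
  · intro f s
    obtain ⟨n, t, ht⟩ := (key f _ (hV f) (inf_le_left.trans (X.basicOpen_le f))
      (inf_le_inf_right W (X.basicOpen_le f))).1 s
    exact ⟨n, t, ht.trans (congrArg (· * (show Γ(X, X.basicOpen f ⊓ W) from s)) (res_res _ _ _).symm)⟩
  · intro f t ht
    exact (key f _ (hV f) (inf_le_left.trans (X.basicOpen_le f))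
      (inf_le_inf_right W (X.basicOpen_le f))).2 t ht

end Quasicoherence

end DAffinity

/-! ### Surjectivity of restriction on D-affine schemes -/

namespace DAffinity

section DAffine

open Limits Scheme.Modules

variable {F : Type u} [Field F] {X : Scheme.{u}} (π : X ⟶ Spec (CommRingCat.of F))

/-- On a D-affine scheme, a morphism of `𝒟`-modules with quasicoherent kernel, source and target is
an epimorphism if it is surjective on global sections. -/
theorem IsDAffine.epi_of_surjective {π : X ⟶ Spec (CommRingCat.of F)} (hD : IsDAffine π)
    {M N : DMod π} (f : M ⟶ N) (hK : OQuasicoherent π (kernel f)) (hM : OQuasicoherent π M)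
    (hN : OQuasicoherent π N) (hf : Epi ((globalSections π).map f)) : Epi f := by
  -- The image is taken as the coimage, a cokernel, so that quasicoherence of cokernels suffices.
  have hI : OQuasicoherent π (Abelian.coimage f) := OQuasicoherent.cokernel π _ hK hM
  have hQ : OQuasicoherent π (Limits.cokernel (Abelian.factorThruCoimage f)) :=
    OQuasicoherent.cokernel π _ hI hN
  let S : ShortComplex (DMod π) :=
    ShortComplex.mk _ _ (cokernel.condition (Abelian.factorThruCoimage f))
  have hS : S.ShortExact :=
    { exact := ShortComplex.exact_cokernel _
      mono_f := inferInstanceAs (Mono (Abelian.factorThruCoimage f))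
      epi_g := inferInstanceAs (Epi (cokernel.π (Abelian.factorThruCoimage f))) }
  have hΓ := hD.exact S hI hN hQ hS
  -- Sections of the image already fill those of `N`, so by exactness the cokernel has no global
  -- sections.
  have h₁ : Epi ((globalSections π).map (Abelian.factorThruCoimage f)) := by
    have h : Epi ((globalSections π).map (Abelian.coimage.π f) ≫
        (globalSections π).map (Abelian.factorThruCoimage f)) := by
      rwa [← Functor.map_comp, Abelian.coimage.fac]
    exact epi_of_epi ((globalSections π).map (Abelian.coimage.π f)) _
  have h₂ : (S.map (globalSections π)).g = 0 := by
    have : Epi (S.map (globalSections π)).f := h₁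
    exact zero_of_epi_comp _ (S.map (globalSections π)).zero
  have h₃ : IsZero ((globalSections π).obj S.X₃) := by
    change IsZero (S.map (globalSections π)).X₃
    have : Epi (S.map (globalSections π)).g := hΓ.epi_g
    exact IsZero.of_epi_eq_zero (S.map (globalSections π)).g h₂
  have h₄ : Epi (Abelian.factorThruCoimage f) :=
    Preadditive.epi_of_isZero_cokernel _ (hD.isZero _ hQ h₃)
  rw [← Abelian.coimage.fac f]
  infer_instance

/-- If every function on the open set `W` of a D-affine scheme extends to a global function, then
locally on `X` every function on `W` extends. -/
theorem IsDAffine.exists_res_eq [NoetherianSpace X] {π : X ⟶ Spec (CommRingCat.of F)}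
    (hD : IsDAffine π) (W : X.Opens)
    (hW : ∀ g : Γ(X, W), ∃ a : Γ(X, ⊤), res le_top a = g)
    (V : X.Opens) (g : Γ(X, V ⊓ W)) (x : X) (hx : x ∈ V) :
    ∃ (V' : X.Opens) (hV : V' ≤ V) (a : Γ(X, V')), x ∈ V' ∧
      res (inf_le_left : V' ⊓ W ≤ V') a = res (inf_le_inf_right W hV) g := by
  have hqc : ∀ W U : X.Opens, IsAffineOpen U →
      IsLocalizingOn ((toModules π).obj (directImage π W)) U := fun W U _ =>
    isLocalizingOn_directImage π W U (NoetherianSpace.isCompact _)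
      fun _ _ _ _ _ _ _ _ => NoetherianSpace.isCompact _
  -- The source, the direct image from `⊤`, plays the role of `𝒪_X`.
  let φ := directImageMap π (le_top : W ≤ ⊤)
  have hφ : Epi φ := by
    refine hD.epi_of_surjective φ (oQuasicoherent_kernel π φ (hqc _) (hqc _))
      (isQuasicoherent_of_isLocalizingOn _ (hqc _)) (isQuasicoherent_of_isLocalizingOn _ (hqc _)) ?_
    rw [ModuleCat.epi_iff_surjective]
    intro g
    obtain ⟨a, ha⟩ := hW (res (le_inf le_top le_rfl) (show Γ(X, ⊤ ⊓ W) from g))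
    refine ⟨(res le_top a : Γ(X, ⊤ ⊓ ⊤)), ?_⟩
    have h := congrArg (res (inf_le_right : ⊤ ⊓ W ≤ W)) ha
    rw [res_res, res_res] at h
    refine (res_res _ _ a).trans (h.trans ?_)
    exact congr($(X.presheaf.map_id (op (⊤ ⊓ W))) _)
  have hs := SheafOfModules.isLocallySurjective_of_epi φ
  obtain ⟨V', i, ⟨a, ha⟩, hx'⟩ := hs.imageSieve_mem (U := V) g x hx
  refine ⟨V', leOfHom i, res (le_inf le_rfl le_top) (show Γ(X, V' ⊓ ⊤) from a), hx', ?_⟩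
  rw [res_res]
  exact ha

end DAffine

end DAffinity

/-! ### Valuations and non-maximal centres -/

/-- A field extension of an algebraically closed field: every element that is not a constant fails
to be integral with respect to some valuation that is trivial on the constants. -/
theorem ValuationSubring.exists_notMem_of_isAlgClosed {k K : Type*} [Field k] [IsAlgClosed k]
    [Field K] (κ : k →+* K) (g : K) (hg : g ∉ κ.range) :
    ∃ O : ValuationSubring K, κ.range ≤ O.toSubring ∧ g ∉ O := by
  -- An integrally closed subring is the intersection of the valuation rings above it.
  have : IsIntegrallyClosedIn κ.range K := by
    rw [Subring.isIntegrallyClosedIn_iff]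
    intro x hx
    let : Algebra k K := κ.toAlgebra
    let : Algebra k κ.range := κ.rangeRestrict.toAlgebra
    have : IsScalarTower k κ.range K := .of_algebraMap_eq fun _ => rfl
    have : Algebra.IsIntegral k κ.range :=
      ⟨RingHom.isIntegral_of_surjective _ κ.rangeRestrict_surjective⟩
    have hx' : IsIntegral k x := isIntegral_trans x hx
    obtain ⟨c, hc⟩ := minpoly.mem_range_of_degree_eq_one k x
      (IsAlgClosed.degree_eq_one_of_irreducible k (minpoly.irreducible hx'))
    exact ⟨c, hc⟩
  obtain ⟨O, hO, h⟩ := Subring.exists_le_valuationSubring_of_isIntegrallyClosedIn hg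
  exact ⟨O, hO, h⟩

/-- The algebra `C = χ(B)[h]` lies in `O`, where `h` is not invertible, so `h` has a minimal prime
`P` in `C`. By Krull `P` has height at most 1, while maximal ideals of `C` have height at least 2.
Modulo `P` the generator `h` disappears, so `B → C ⧸ P` is onto and the contraction `q` of `P` is
not maximal either. -/
theorem Ideal.exists_isPrime_not_isMaximal_of_valuationSubring {k K A B : Type u}
    [Field k] [Field K] [Algebra k K]
    [CommRing A] [Algebra k A] [Algebra.FiniteType k A] (i : A →ₐ[k] K)
    (hi : Function.Injective i) (hA : 2 ≤ ringKrullDim A)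
    [CommRing B] [Algebra k B] [Algebra.FiniteType k B] (χ : B →ₐ[k] K)
    (hfrac : ∀ u : K, ∃ a b : B, χ b ≠ 0 ∧ u * χ b = χ a)
    (O : ValuationSubring K) (hχ : ∀ b, χ b ∈ O) (h : K) (hO : h⁻¹ ∉ O) :
    ∃ q : Ideal B, q.IsPrime ∧ ¬ q.IsMaximal ∧ ∀ a b, χ a = χ b * h → a ∈ q := by
  have hhO : h ∈ O := (O.mem_or_inv_mem h).resolve_right hO
  let θ : Polynomial B →ₐ[k] K := { Polynomial.eval₂RingHom χ.toRingHom h with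
      commutes' := fun c => (Polynomial.eval₂_C _ _).trans (χ.commutes c) }
  have hθ (p) : θ p = p.eval₂ χ.toRingHom h := rfl
  let C : Subalgebra k K := θ.range
  have hCO : ∀ c : C, (c : K) ∈ O := by
    rintro ⟨-, p, rfl⟩
    change p.eval₂ χ.toRingHom h ∈ O
    induction p using Polynomial.induction_on' with
    | add p q hp hq => rw [Polynomial.eval₂_add]; exact add_mem hp hq
    | monomial n a => rw [Polynomial.eval₂_monomial]; exact mul_mem (hχ a) (pow_mem hhO n)
  have : Algebra.FiniteType k C :=
    Algebra.FiniteType.of_surjective (θ.rangeRestrict) θ.rangeRestrict_surjective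
  let hC : C := θ.rangeRestrict Polynomial.X
  have hhC : (hC : K) = h := by simp [hC, hθ]
  let ψ : B →ₐ[k] C := θ.rangeRestrict.comp (Polynomial.CAlgHom (R := k) (A := B))
  have hψ (b) : (ψ b : K) = χ b := by
    change θ (Polynomial.C b) = χ b
    rw [hθ, Polynomial.eval₂_C]; rfl
  have hne : Ideal.span {hC} ≠ ⊤ := by
    rw [Ne, Ideal.span_singleton_eq_top]
    intro hu
    obtain ⟨c, hc⟩ := hu.exists_right_inv
    have h1 : h * c = 1 := by rw [← hhC]; exact congrArg Subtype.val hc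
    exact hO (eq_inv_of_mul_eq_one_right h1 ▸ hCO c)
  obtain ⟨m, hm, hle⟩ := Ideal.exists_le_maximal _ hne
  obtain ⟨P, hP, -⟩ := Ideal.exists_minimalPrimes_le hle
  have hPp : P.IsPrime := hP.1.1
  have hhP : hC ∈ P := hP.1.2 (Ideal.mem_span_singleton_self _)
  have : IsNoetherianRing C := Algebra.FiniteType.isNoetherianRing k C
  have hht : P.height ≤ 1 := Ideal.height_le_one_of_isPrincipal_of_mem_minimalPrimes _ P hP
  refine ⟨P.comap ψ, inferInstance, fun hmax => ?_, fun a b hab => ?_⟩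
  · have hsurj : Function.Surjective ((Ideal.Quotient.mk P).comp ψ.toRingHom) := by
      intro c
      obtain ⟨⟨-, p, rfl⟩, rfl⟩ := Ideal.Quotient.mk_surjective c
      refine ⟨p.coeff 0, Ideal.Quotient.eq.mpr ?_⟩
      have e : ψ (p.coeff 0) - θ.rangeRestrict p = - (hC * θ.rangeRestrict p.divX) := by
        conv_lhs => rw [← Polynomial.X_mul_divX_add p, map_add, map_mul]
        simp [ψ, hC]
      exact e ▸ neg_mem (P.mul_mem_right _ hhP)
    have hmap : (P.comap ψ).map ((Ideal.Quotient.mk P).comp ψ.toRingHom) = ⊥ := by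
      rw [Ideal.map_eq_bot_iff_le_ker]
      intro b hb
      exact Ideal.Quotient.eq_zero_iff_mem.mpr hb
    -- The image of a maximal ideal under a surjection is maximal or everything; here it is zero in
    -- a nonzero ring.
    have hbot : (⊥ : Ideal (C ⧸ P)).IsMaximal :=
      hmap ▸ (Ideal.map_eq_top_or_isMaximal_of_surjective _ hsurj hmax).resolve_left
        (hmap ▸ bot_ne_top)
    have hPm : P.IsMaximal := Ideal.bot_quotient_isMaximal_iff P |>.mp hbot
    have := Ideal.two_le_height_of_isMaximal i hi hA C.val Subtype.val_injective
      (fun u => by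
        obtain ⟨a, b, hb, hab⟩ := hfrac u
        exact ⟨ψ a, ψ b, by simpa [hψ] using hb, by simpa [hψ] using hab⟩) P
    exact absurd (this.trans hht) (by decide)
  · have : ψ a = ψ b * hC := Subtype.ext (by simp [hψ, hab, hhC])
    change ψ a ∈ P
    exact this ▸ P.mul_mem_left _ hhP

/-! ### Evaluation at points and centres of valuations -/

namespace AlgebraicGeometry.Scheme

lemma Hom.top_le_preimage_top {X Y : Scheme.{u}} (f : X ⟶ Y) : ⊤ ≤ f ⁻¹ᵁ ⊤ := le_top

lemma Hom.top_le_preimage_of_comp {X Y Z : Scheme.{u}} {g : X ⟶ Y} {f : Y ⟶ Z} {h : X ⟶ Z}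
    (hgf : g ≫ f = h) {U : Z.Opens} (e : ⊤ ≤ f ⁻¹ᵁ U) : ⊤ ≤ h ⁻¹ᵁ U := by
  subst hgf
  exact fun _ _ => e trivial

lemma Hom.appLE_top_top {X Y : Scheme.{u}} (f : X ⟶ Y) (e : ⊤ ≤ f ⁻¹ᵁ ⊤) :
    f.appLE ⊤ ⊤ e = f.appTop :=
  (Hom.app_eq_appLE f).symm

lemma Hom.appLE_comp_appTop {X Y Z : Scheme.{u}} {g : X ⟶ Y} {f : Y ⟶ Z} {h : X ⟶ Z}
    (hgf : g ≫ f = h) (U : Z.Opens) (e : ⊤ ≤ f ⁻¹ᵁ U) :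
    f.appLE U ⊤ e ≫ g.appTop = h.appLE U ⊤ (Hom.top_le_preimage_of_comp hgf e) := by
  subst hgf
  rw [← Hom.appLE_top_top g g.top_le_preimage_top, Hom.appLE_comp_appLE]

lemma fromSpecResidueField_appLE_top {X : Scheme.{u}} (x : X) (U : X.Opens) (hx : x ∈ U)
    (e : ⊤ ≤ X.fromSpecResidueField x ⁻¹ᵁ U) :
    (X.fromSpecResidueField x).appLE U ⊤ e ≫ (ΓSpecIso _).hom = X.evaluation U x hx := by
  have e' : ⊤ ≤ Spec.map (X.residue x) ⁻¹ᵁ X.fromSpecStalk x ⁻¹ᵁ U := e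
  have h₁ : (X.fromSpecResidueField x).appLE U ⊤ e =
      (X.fromSpecStalk x).app U ≫ (Spec.map (X.residue x)).appLE (X.fromSpecStalk x ⁻¹ᵁ U) ⊤ e' :=
    Hom.comp_appLE _ _ _ _ _
  have h₂ : ((Spec _).presheaf.map (homOfLE le_top).op) ≫
      (Spec.map (X.residue x)).appLE (X.fromSpecStalk x ⁻¹ᵁ U) ⊤ e' =
      (Spec.map (X.residue x)).appTop :=
    (Hom.map_appLE _ _ _).trans (Hom.appLE_top_top _ _)
  rw [h₁, fromSpecStalk_app hx, Category.assoc, Category.assoc, Category.assoc, reassoc_of% h₂,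
    ΓSpecIso_naturality, Iso.inv_hom_id_assoc, germ_residue]

/-- With `R` a valuation ring of the residue field and `l` the lift from the valuative criterion,
this puts values of functions in `R`. -/
lemma appLE_comp_ΓSpecIso_hom_eq_evaluation {X : Scheme.{u}} {R : CommRingCat.{u}} (x : X)
    (i : R ⟶ X.residueField x) (l : Spec R ⟶ X) (hl : Spec.map i ≫ l = X.fromSpecResidueField x)
    (U : X.Opens) (hx : x ∈ U) (e : ⊤ ≤ l ⁻¹ᵁ U) :
    l.appLE U ⊤ e ≫ (ΓSpecIso R).hom ≫ i = X.evaluation U x hx := by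
  rw [← ΓSpecIso_naturality, reassoc_of% Hom.appLE_comp_appTop hl U e,
    fromSpecResidueField_appLE_top x U hx]

lemma fromSpecResidueField_comp_eq_Spec_map {X : Scheme.{u}} {R : CommRingCat.{u}}
    (π : X ⟶ Spec R) (x : X) :
    X.fromSpecResidueField x ≫ π =
      Spec.map ((ΓSpecIso R).inv ≫ π.appTop ≫ X.Γevaluation x) := by
  refine ext_of_isAffine ?_
  rw [Hom.comp_appTop]
  have h : (X.fromSpecResidueField x).appTop = X.Γevaluation x ≫ (ΓSpecIso _).inv := by
    rw [Iso.eq_comp_inv, Γevaluation,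
      ← fromSpecResidueField_appLE_top x ⊤ trivial (Hom.top_le_preimage_top _),
      Hom.appLE_top_top]
  rw [h, ← cancel_mono (ΓSpecIso _).hom, ΓSpecIso_naturality]
  simp

end AlgebraicGeometry.Scheme

namespace AlgebraicGeometry

open IsLocalRing

/-- By the valuative criterion `x` extends to `Spec O → X`. An affine neighbourhood in `Y` of the
image of the closed point pulls back to all of `Spec O`, since `O` is local. -/
theorem UniversallyClosed.exists_isAffineOpen_evaluation_mem {R : CommRingCat.{u}} {X Y : Scheme.{u}}
    (π : X ⟶ Spec R) [UniversallyClosed π] (f : X ⟶ Y) (x : X)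
    (O : ValuationSubring (X.residueField x))
    (hO : ((Scheme.ΓSpecIso R).inv ≫ π.appTop ≫ X.Γevaluation x).hom.range ≤ O.toSubring) :
    ∃ (U : Y.Opens) (_ : IsAffineOpen U) (hx : x ∈ f ⁻¹ᵁ U),
      ∀ a : Γ(Y, U), X.evaluation (f ⁻¹ᵁ U) x hx (f.app U a) ∈ O := by
  have hex : ValuativeCriterion.Existence π := by
    have := UniversallyClosed.eq_valuativeCriterion ▸ ‹UniversallyClosed π›
    exact this.1
  let κ := (Scheme.ΓSpecIso R).inv ≫ π.appTop ≫ X.Γevaluation x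
  let κ' : R ⟶ .of O := CommRingCat.ofHom (κ.hom.codRestrict O.toSubring fun a => hO ⟨a, rfl⟩)
  let ι : CommRingCat.of O ⟶ X.residueField x :=
    CommRingCat.ofHom (algebraMap O (X.residueField x))
  have w : X.fromSpecResidueField x ≫ π = Spec.map ι ≫ Spec.map κ' := by
    rw [Scheme.fromSpecResidueField_comp_eq_Spec_map, ← Spec.map_comp]
    rfl
  obtain ⟨l, hl⟩ : ∃ l : Spec (.of O) ⟶ X, Spec.map ι ≫ l = X.fromSpecResidueField x := by
    obtain ⟨l, hl, -⟩ :=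
      (hex { R := O, K := X.residueField x, commSq := CommSq.mk w, .. }).exists_lift
    exact ⟨l, hl⟩
  obtain ⟨U, hU, hyU, -⟩ := exists_isAffineOpen_mem_and_subset
    (X := Y) (x := f (l (closedPoint O))) (U := ⊤) trivial
  have e : ⊤ ≤ l ⁻¹ᵁ f ⁻¹ᵁ U := (Scheme.preimage_eq_top_of_closedPoint_mem l hyU).ge
  have hxU : x ∈ f ⁻¹ᵁ U := by
    have : (Spec.map ι ≫ l) (closedPoint (X.residueField x)) ∈ f ⁻¹ᵁ U := e trivial
    rw [hl] at this
    exact (Scheme.fromSpecResidueField_apply x _).symm ▸ this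
  refine ⟨U, hU, hxU, fun a => ?_⟩
  rw [← Scheme.appLE_comp_ΓSpecIso_hom_eq_evaluation x ι l hl (f ⁻¹ᵁ U) hxU e]
  exact ((l.appLE (f ⁻¹ᵁ U) ⊤ e ≫ (Scheme.ΓSpecIso _).hom) (f.app U a)).2

end AlgebraicGeometry

/-! ### Transfer of functions along `f` where it is an isomorphism -/

namespace AlgebraicGeometry

lemma isIso_app_of_isIso_morphismRestrict {X Y : Scheme.{u}} (f : X ⟶ Y) (V : Y.Opens)
    [IsIso (f ∣_ V)] (W : Y.Opens) (hW : W ≤ V) : IsIso (f.app W) := by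
  have h₀ : IsIso ((f ∣_ V).app (V.ι ⁻¹ᵁ W)) := inferInstance
  have h := morphismRestrict_app f V (V.ι ⁻¹ᵁ W)
  have h' : IsIso (f.app (V.ι ''ᵁ (V.ι ⁻¹ᵁ W))) := by
    have : IsIso (f.app (V.ι ''ᵁ (V.ι ⁻¹ᵁ W)) ≫ X.presheaf.map
      (eqToHom (image_morphismRestrict_preimage f V (V.ι ⁻¹ᵁ W))).op) := by
      rw [← h]
      exact h₀
    exact IsIso.of_isIso_comp_right _ (X.presheaf.map
      (eqToHom (image_morphismRestrict_preimage f V (V.ι ⁻¹ᵁ W))).op)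
  have e : V.ι ''ᵁ (V.ι ⁻¹ᵁ W) = W := by
    simpa [Scheme.Hom.image_preimage_eq_opensRange_inf] using hW
  exact e ▸ h'

lemma isIso_stalkMap_of_isIso_morphismRestrict {X Y : Scheme.{u}} (f : X ⟶ Y) (V : Y.Opens)
    [IsIso (f ∣_ V)] (x : X) (hx : f x ∈ V) : IsIso (f.stalkMap x) := by
  have (y : (f ⁻¹ᵁ V).toScheme) : IsIso ((f ∣_ V).stalkMap y) := inferInstance
  exact ((MorphismProperty.isomorphisms _).arrow_mk_iso_iff
    (morphismRestrictStalkMap f V ⟨x, hx⟩)).mp (this _)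

/-- The residue field at `x` is a quotient of the stalk of `Y` at `f x`, which is a localization of
`Γ(Y, U)`. -/
lemma exists_evaluation_div {X Y : Scheme.{u}} (f : X ⟶ Y) (x : X) [IsIso (f.stalkMap x)]
    (U : Y.Opens) (hU : IsAffineOpen U) (hx : x ∈ f ⁻¹ᵁ U) (u : X.residueField x) :
    ∃ a b : Γ(Y, U), X.evaluation (f ⁻¹ᵁ U) x hx (f.app U b) ≠ 0 ∧
      u * X.evaluation (f ⁻¹ᵁ U) x hx (f.app U b) = X.evaluation (f ⁻¹ᵁ U) x hx (f.app U a) := by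
  have hev (a : Γ(Y, U)) : X.evaluation (f ⁻¹ᵁ U) x hx (f.app U a) =
      X.residue x (f.stalkMap x (Y.presheaf.germ U (f x) hx a)) := by
    exact (congr(X.residue x ($(Scheme.Hom.germ_stalkMap f U x hx) a))).symm
  obtain ⟨s, rfl⟩ := X.residue_surjective x u
  obtain ⟨t, rfl⟩ := (ConcreteCategory.bijective_of_isIso (f.stalkMap x)).2 s
  let := Y.presheaf.algebra_section_stalk ⟨f x, hx⟩
  have hloc := hU.isLocalization_stalk ⟨f x, hx⟩
  obtain ⟨⟨a, b⟩, hab⟩ := IsLocalization.surj (hU.primeIdealOf ⟨f x, hx⟩).asIdeal.primeCompl t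
  refine ⟨a, b, ?_, ?_⟩
  · rw [hev]
    have hu : IsUnit (Y.presheaf.germ U (f x) hx b) := IsLocalization.map_units _ b
    exact ((hu.map (f.stalkMap x).hom).map (X.residue x).hom).ne_zero
  · rw [hev, hev, ← map_mul, ← map_mul]
    exact congrArg (fun t => X.residue x (f.stalkMap x t)) hab

end AlgebraicGeometry

/-- The closed points in `T` are dense in `T`; being finite in number they form a closed set, hence
are all of `T`. -/
lemma JacobsonSpace.isClosed_singleton_of_finite {X : Type*} [TopologicalSpace X] [JacobsonSpace X]
    {T : Set X} (hT : T.Finite) (hc : IsClosed T) {x : X} (hx : x ∈ T) : IsClosed {x} := by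
  have h : closure (T ∩ closedPoints X) = T := JacobsonSpace.closure_inter_closedPoints hc
  rw [IsClosed.closure_eq] at h
  · exact (h.symm ▸ hx : x ∈ T ∩ closedPoints X).2
  · rw [← Set.biUnion_of_singleton (T ∩ closedPoints X)]
    exact (hT.subset Set.inter_subset_left).isClosed_biUnion fun y hy => hy.2

namespace DAffinity

variable {F : Type u} [Field F] {X Y : Scheme.{u}}

/-- The structure map from the base field to the residue field at a point. -/
noncomputable def scalarAt (π : X ⟶ Spec (CommRingCat.of F)) (x : X) : F →+* X.residueField x :=
  ((Scheme.ΓSpecIso (CommRingCat.of F)).inv ≫ π.appTop ≫ X.Γevaluation x).hom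

lemma evaluation_res {V W : X.Opens} (h : W ≤ V) (x : X) (hx : x ∈ W) (g : Γ(X, V)) :
    X.evaluation W x hx (res h g) = X.evaluation V x (h hx) g := by
  simp only [res, ← Scheme.germ_residue, CommRingCat.comp_apply]
  exact congrArg (X.residue x) (X.presheaf.germ_res_apply (homOfLE h) x hx g)

lemma evaluation_scalar (π : X ⟶ Spec (CommRingCat.of F)) (x : X) (U : X.Opens) (hx : x ∈ U)
    (c : F) : X.evaluation U x hx (scalar π U c) = scalarAt π x c :=
  evaluation_res le_top x hx _

lemma app_res (f : X ⟶ Y) {V W : Y.Opens} (h : W ≤ V) (g : Γ(Y, V)) :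
    f.app W (res h g) = res (f.preimage_mono h) (f.app V g) := by
  simp only [res]
  exact congr($(f.naturality (homOfLE h).op) g)

lemma app_scalar {π : X ⟶ Spec (CommRingCat.of F)} {ρ : Y ⟶ Spec (CommRingCat.of F)} {f : X ⟶ Y}
    (hf : f ≫ ρ = π) (U : Y.Opens) (c : F) : f.app U (scalar ρ U c) = scalar π (f ⁻¹ᵁ U) c := by
  subst hf
  simp only [scalar, RingHom.comp_apply]
  rw [app_res]
  simp
  rfl

lemma finiteType_scalar (ρ : Y ⟶ Spec (CommRingCat.of F)) [LocallyOfFiniteType ρ] (U : Y.Opens)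
    (hU : IsAffineOpen U) : (scalar ρ U).FiniteType := by
  have h := ρ.finiteType_appLE (isAffineOpen_top _) hU le_top
  refine h.comp (RingHom.FiniteType.of_surjective _ ?_)
  exact (ConcreteCategory.bijective_of_isIso (Scheme.ΓSpecIso (CommRingCat.of F)).inv).2

end DAffinity

/-! ### Constancy at points of large transcendence degree -/

namespace DAffinity

variable {F : Type u} [Field F] {X Y : Scheme.{u}}

/-- A function on the complement of the fibres over finitely many points of a morphism that is an
isomorphism there is constant at every point of transcendence degree at least two. -/
theorem exists_evaluation_eq_scalarAt [IsAlgClosed F] (π : X ⟶ Spec (CommRingCat.of F))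
    [UniversallyClosed π] (ρ : Y ⟶ Spec (CommRingCat.of F)) [LocallyOfFiniteType ρ]
    (f : X ⟶ Y) (hf : f ≫ ρ = π) (V : Y.Opens) (hV : ((V : Set Y)ᶜ).Finite) [IsIso (f ∣_ V)]
    (x : X) (hx : x ∈ f ⁻¹ᵁ V) {A : Type u} [CommRing A] [Algebra F A] [Algebra.FiniteType F A]
    (i : A →+* X.residueField x) (hi : Function.Injective i)
    (hiF : ∀ c, i (algebraMap F A c) = scalarAt π x c) (hA : 2 ≤ ringKrullDim A)
    (g : Γ(X, f ⁻¹ᵁ V)) : ∃ c, X.evaluation (f ⁻¹ᵁ V) x hx g = scalarAt π x c := by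
  by_contra! hg
  let K := X.residueField x
  let u : K := X.evaluation (f ⁻¹ᵁ V) x hx g
  obtain ⟨O, hO, hgO⟩ := ValuationSubring.exists_notMem_of_isAlgClosed (scalarAt π x) u
    (by rintro ⟨c, hc⟩; exact hg c hc.symm)
  have hu0 : u ≠ 0 := fun h => hgO (h ▸ zero_mem O)
  obtain ⟨U, hU, hxU, hUO⟩ := UniversallyClosed.exists_isAffineOpen_evaluation_mem π f x O hO
  let : Algebra F K := (scalarAt π x).toAlgebra
  let : Algebra F Γ(Y, U) := (scalar ρ U).toAlgebra
  have : Algebra.FiniteType F Γ(Y, U) := finiteType_scalar ρ U hU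
  let χ : Γ(Y, U) →ₐ[F] K :=
    { (f.app U ≫ X.evaluation (f ⁻¹ᵁ U) x hxU).hom with
      commutes' := fun c => by
        change X.evaluation (f ⁻¹ᵁ U) x hxU (f.app U (scalar ρ U c)) = scalarAt π x c
        rw [app_scalar hf, evaluation_scalar] }
  have hχ (a : Γ(Y, U)) : χ a = X.evaluation (f ⁻¹ᵁ U) x hxU (f.app U a) := rfl
  have := isIso_stalkMap_of_isIso_morphismRestrict f V x hx
  obtain ⟨q, hq, hqm, hqh⟩ := Ideal.exists_isPrime_not_isMaximal_of_valuationSubring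
    { i with commutes' := hiF } hi hA χ (exists_evaluation_div f x U hU hxU) O hUO u⁻¹
    (by rwa [inv_inv])
  let y : Y := hU.fromSpec ⟨q, hq⟩
  have hyU : y ∈ U := by
    rw [← SetLike.mem_coe, ← hU.range_fromSpec]
    exact ⟨_, rfl⟩
  -- All points of the finite closed complement of `V` are closed, but `q` is not maximal.
  have hyV : y ∈ V := by
    by_contra hyV
    have : JacobsonSpace Y := LocallyOfFiniteType.jacobsonSpace ρ
    have hc := JacobsonSpace.isClosed_singleton_of_finite hV V.isOpen.isClosed_compl hyV
    refine hqm ((PrimeSpectrum.isClosed_singleton_iff_isMaximal ⟨q, hq⟩).mp ?_)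
    have h := hc.preimage hU.fromSpec.continuous
    rw [show ({y} : Set Y) = hU.fromSpec '' {⟨q, hq⟩} from
      (Set.image_singleton (f := hU.fromSpec) (a := ⟨q, hq⟩)).symm, Set.preimage_image_eq _ hU.fromSpec.isOpenEmbedding.injective] at h
    exact h
  obtain ⟨a, haV, hya⟩ := hU.exists_basicOpen_le ⟨y, hyV⟩ hyU
  have haq : a ∉ q := by
    have : (⟨q, hq⟩ : PrimeSpectrum Γ(Y, U)) ∈ hU.fromSpec ⁻¹ᵁ Y.basicOpen a := hya
    rw [hU.fromSpec_preimage_basicOpen] at this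
    exact this
  have hxa : x ∈ f ⁻¹ᵁ Y.basicOpen a := by
    -- The numerator relation with zero right-hand side shows that `q` contains the kernel of `χ`.
    have h : χ a ≠ 0 := fun h => haq (hqh a 0 (by rw [h, map_zero, zero_mul]))
    have h' := (X.evaluation_ne_zero_iff_mem_basicOpen x hxU (f.app U a)).mp h
    rw [← Scheme.preimage_basicOpen] at h'
    exact h'
  have := isIso_app_of_isIso_morphismRestrict f V _ haV
  obtain ⟨g', hg'⟩ := (ConcreteCategory.bijective_of_isIso (f.app (Y.basicOpen a))).2
    (res (f.preimage_mono haV) g)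
  have hloc := hU.isLocalization_basicOpen a
  obtain ⟨⟨b, ⟨-, n, rfl⟩⟩, hb⟩ := IsLocalization.surj (Submonoid.powers a) g'
  have hb' : g' * res (Y.basicOpen_le a) (a ^ n) = res (Y.basicOpen_le a) b := hb
  -- Near `y` the function `g` is `b / a ^ n`, so `χ (a ^ n) = χ b * u⁻¹` forces `a ^ n ∈ q`,
  -- against the choice of `a`.
  have key : u * χ (a ^ n) = χ b := by
    have h := congrArg (fun t => X.evaluation (f ⁻¹ᵁ Y.basicOpen a) x hxa
      (f.app (Y.basicOpen a) t)) hb'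
    simp only [map_mul] at h
    rw [app_res, app_res, evaluation_res, evaluation_res, hg', evaluation_res] at h
    exact h
  refine haq (hq.mem_of_pow_mem n (hqh _ b ?_))
  rw [← key, mul_right_comm, mul_inv_cancel₀ hu0, one_mul]

end DAffinity

/-! ### Specialization, properness and dimension in affine charts -/

namespace AlgebraicGeometry.IsAffineOpen

variable {X : Scheme.{u}} {U : X.Opens} (hU : IsAffineOpen U)

lemma fromSpec_specializes_iff (p q : PrimeSpectrum Γ(X, U)) :
    hU.fromSpec p ⤳ hU.fromSpec q ↔ p ≤ q :=
  hU.fromSpec.isOpenEmbedding.isInducing.specializes_iff.trans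
    (PrimeSpectrum.le_iff_specializes p q).symm

lemma primeIdealOf_le_iff (x y : U) : hU.primeIdealOf x ≤ hU.primeIdealOf y ↔ (x : X) ⤳ y := by
  rw [← hU.fromSpec_specializes_iff, hU.fromSpec_primeIdealOf, hU.fromSpec_primeIdealOf]

lemma mem_basicOpen_iff_notMem_primeIdealOf (x : U) (a : Γ(X, U)) :
    (x : X) ∈ X.basicOpen a ↔ a ∉ (hU.primeIdealOf x).asIdeal := by
  have h : hU.primeIdealOf x ∈ hU.fromSpec ⁻¹ᵁ X.basicOpen a ↔
      a ∉ (hU.primeIdealOf x).asIdeal := by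
    rw [hU.fromSpec_preimage_basicOpen]
    rfl
  have h' : hU.fromSpec (hU.primeIdealOf x) ∈ X.basicOpen a ↔
      a ∉ (hU.primeIdealOf x).asIdeal := h
  rwa [hU.fromSpec_primeIdealOf] at h'

end AlgebraicGeometry.IsAffineOpen

namespace DAffinity

section

attribute [local instance] MvPolynomial.gradedAlgebra

/-- `Proj` is universally closed over the spectrum of its degree zero part, which consists of
constants; surjectivity of `F` onto it makes the remaining map a closed immersion. -/
lemma universallyClosed_projSpaceToSpec (F : Type u) [Field F] (n : ℕ) :
    UniversallyClosed (projSpaceToSpec F n) := by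
  have : Algebra.FiniteType (MvPolynomial.homogeneousSubmodule (Fin (n + 1)) F 0)
      (MvPolynomial (Fin (n + 1)) F) := by
    have h : (algebraMap F (MvPolynomial (Fin (n + 1)) F)).FiniteType :=
      RingHom.finiteType_algebraMap.mpr inferInstance
    exact RingHom.finiteType_algebraMap.mp (RingHom.FiniteType.of_comp_finiteType
      (f := algebraMap F (MvPolynomial.homogeneousSubmodule (Fin (n + 1)) F 0)) h)
  have hs : Function.Surjective
      (algebraMap F (MvPolynomial.homogeneousSubmodule (Fin (n + 1)) F 0)) := by
    rintro ⟨p, hp⟩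
    refine ⟨p.coeff 0, Subtype.ext ?_⟩
    exact (MvPolynomial.totalDegree_eq_zero_iff_eq_C.mp
      (Nat.le_zero.mp (MvPolynomial.IsHomogeneous.totalDegree_le hp))).symm
  have := IsClosedImmersion.spec_of_surjective (CommRingCat.ofHom
      (algebraMap F (MvPolynomial.homogeneousSubmodule (Fin (n + 1)) F 0))) hs
  unfold projSpaceToSpec
  infer_instance

end

variable {F : Type u} [Field F] {X : Scheme.{u}}

lemma IsProjectiveOver.universallyClosed {π : X ⟶ Spec (CommRingCat.of F)}
    (h : IsProjectiveOver π) : UniversallyClosed π := by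
  obtain ⟨n, i, hi, rfl⟩ := h
  have := universallyClosed_projSpaceToSpec F n
  infer_instance

lemma IsVariety.noetherianSpace {π : X ⟶ Spec (CommRingCat.of F)} (h : IsVariety π) :
    NoetherianSpace X := by
  have := h.locallyOfFiniteType
  have := h.quasiCompact
  have : IsLocallyNoetherian X := LocallyOfFiniteType.isLocallyNoetherian π
  have : CompactSpace X := QuasiCompact.compactSpace_of_compactSpace π
  have : IsNoetherian X := {}
  infer_instance

/-- The algebra of functions of the closure of a point in an affine neighbourhood of a
specialization has the expected dimension. -/
theorem exists_injective_residueField_of_two_le_topologicalKrullDim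
    (π : X ⟶ Spec (CommRingCat.of F)) [LocallyOfFiniteType π] (x : X)
    (hx : 2 ≤ topologicalKrullDim (closure {x} : Set X)) :
    ∃ (A : Type u) (_ : CommRing A) (_ : Algebra F A) (_ : Algebra.FiniteType F A)
      (i : A →+* X.residueField x), Function.Injective i ∧
        (∀ c, i (algebraMap F A c) = scalarAt π x c) ∧ 2 ≤ ringKrullDim A := by
  obtain ⟨l, hl⟩ := Order.le_krullDim_iff.mp (show ((2 : ℕ) : WithBot ℕ∞) ≤ _ from hx)
  have : QuasiSober (closure {x} : Set X) :=
    (isClosed_closure.isClosedEmbedding_subtypeVal).quasiSober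
  choose z hz using fun j => QuasiSober.sober (l j).isIrreducible (l j).isClosed
  have hlt : ∀ j j', j < j' → (z j' : X) ⤳ z j ∧ ¬ (z j : X) ⤳ z j' := by
    intro j j' hjj
    have h := l.strictMono hjj
    have hval (a b : (closure {x} : Set X)) : (a : X) ⤳ b ↔ a ⤳ b :=
      Topology.IsInducing.subtypeVal.specializes_iff
    rw [hval, hval, specializes_iff_closure_subset, specializes_iff_closure_subset, (hz j).def, (hz j').def]
    exact ⟨h.le, h.not_ge⟩
  have h01 := hlt ⟨0, by omega⟩ ⟨1, by omega⟩ (by simp [Fin.lt_def])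
  have h12 := hlt ⟨1, by omega⟩ ⟨2, by omega⟩ (by simp [Fin.lt_def])
  set z₀ := z ⟨0, by omega⟩
  set z₁ := z ⟨1, by omega⟩
  set z₂ := z ⟨2, by omega⟩
  -- The point `z₀` is the most special of the chain, so its neighbourhood contains `z₁`, `z₂` and
  -- `x`.
  obtain ⟨U, hU, h₀, -⟩ := exists_isAffineOpen_mem_and_subset (X := X) (x := z₀) (U := ⊤) trivial
  have h₁ : (z₁ : X) ∈ U := h01.1.mem_open U.isOpen h₀
  have h₂ : (z₂ : X) ∈ U := h12.1.mem_open U.isOpen h₁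
  have hxU : x ∈ U := (specializes_iff_mem_closure.mpr z₀.2).mem_open U.isOpen h₀
  let : Algebra F Γ(X, U) := (scalar π U).toAlgebra
  have : Algebra.FiniteType F Γ(X, U) := finiteType_scalar π U hU
  let e := (X.evaluation U x hxU).hom
  have hlt' : ∀ (y y' : X) (hy : y ∈ U) (hy' : y' ∈ U), y ⤳ y' → ¬ y' ⤳ y →
      hU.primeIdealOf ⟨y, hy⟩ < hU.primeIdealOf ⟨y', hy'⟩ := fun y y' hy hy' h h' =>
    lt_of_le_not_ge ((hU.primeIdealOf_le_iff _ _).mpr h)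
      (fun hle => h' ((hU.primeIdealOf_le_iff _ _).mp hle))
  have hker : ∀ (y : X) (hy : y ∈ U), y ∈ closure {x} →
      hU.primeIdealOf ⟨y, hy⟩ ∈ PrimeSpectrum.zeroLocus (RingHom.ker e : Set Γ(X, U)) := by
    intro y hy hxy a ha
    by_contra hya
    have hxa := (specializes_iff_mem_closure.mpr hxy).mem_open (X.basicOpen a).isOpen
      ((hU.mem_basicOpen_iff_notMem_primeIdealOf ⟨y, hy⟩ a).mpr hya)
    exact (X.evaluation_ne_zero_iff_mem_basicOpen x hxU a).mpr hxa ha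
  refine ⟨Γ(X, U) ⧸ RingHom.ker e, inferInstance, inferInstance, inferInstance,
    RingHom.kerLift e, RingHom.kerLift_injective e, fun c => evaluation_scalar π x U hxU c, ?_⟩
  rw [ringKrullDim_quotient]
  refine Order.le_krullDim_iff (n := 2).mpr ⟨{
    length := 2
    toFun := ![⟨_, hker z₂ h₂ z₂.2⟩, ⟨_, hker z₁ h₁ z₁.2⟩, ⟨_, hker z₀ h₀ z₀.2⟩]
    step := ?_ }, rfl⟩
  rw [Fin.forall_fin_two]
  exact ⟨hlt' _ _ h₂ h₁ h12.1 h12.2, hlt' _ _ h₁ h₀ h01.1 h01.2⟩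

/-- A function that is not a zero divisor does not vanish at the generic points. -/
lemma mem_basicOpen_of_mem_nonZeroDivisors (x : X) (hx : closure {x} ∈ irreducibleComponents X)
    (U : X.Opens) (hU : IsAffineOpen U) (hxU : x ∈ U) (s : Γ(X, U)) (hs : s ∈ nonZeroDivisors _) :
    x ∈ X.basicOpen s := by
  have hmin : (hU.primeIdealOf ⟨x, hxU⟩).asIdeal ∈ minimalPrimes Γ(X, U) := by
    refine ⟨⟨(hU.primeIdealOf ⟨x, hxU⟩).2, bot_le⟩, fun q hq hqp => ?_⟩
    have hx' := hU.fromSpec_primeIdealOf ⟨x, hxU⟩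
    have h := (hU.fromSpec_specializes_iff ⟨q, hq.1⟩ (hU.primeIdealOf ⟨x, hxU⟩)).mpr hqp
    rw [hx', specializes_iff_closure_subset] at h
    have h' := specializes_iff_closure_subset.mpr (hx.2 isIrreducible_singleton.closure h)
    refine (hU.fromSpec_specializes_iff (hU.primeIdealOf ⟨x, hxU⟩) ⟨q, hq.1⟩).mp ?_
    rw [hx']
    exact h'
  exact (hU.mem_basicOpen_iff_notMem_primeIdealOf ⟨x, hxU⟩ s).mpr fun h =>
    Set.disjoint_left.mp (Ideal.disjoint_nonZeroDivisors_of_mem_minimalPrimes hmin) h hs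

end DAffinity

/-! ### From finitely many values to constants, and extension of inverses -/

namespace DAffinity

/-- In a noetherian space, the connected component of a point of an open subset is open and
closed in it. -/
lemma exists_indecomposable_open_nhd {X : Type*} [TopologicalSpace X] [NoetherianSpace X]
    (U : Opens X) (x : X) (hx : x ∈ U) :
    ∃ W M : Opens X, x ∈ W ∧ W ⊓ M = ⊥ ∧ W ⊔ M = U ∧
      ∀ W₁ W₂ : Opens X, x ∈ W₁ → W₁ ⊓ W₂ = ⊥ → W₁ ⊔ W₂ = W → W₂ = ⊥ := by
  let S : Set (Opens X) := {M | ∃ W : Opens X, x ∈ W ∧ W ⊓ M = ⊥ ∧ W ⊔ M = U}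
  -- Choose the complementary piece `M` maximal; splitting `W₂` off `W` would enlarge it.
  obtain ⟨M, ⟨W, hxW, hWM, hU⟩, hmax⟩ := WellFounded.has_min
    (wellFounded_gt : WellFounded ((· > ·) : Opens X → Opens X → Prop)) S
    ⟨⊥, U, hx, inf_bot_eq _, sup_bot_eq _⟩
  refine ⟨W, M, hxW, hWM, hU, fun W₁ W₂ hx₁ h₁₂ hW => ?_⟩
  have hM : ¬ M < W₂ ⊔ M := fun h => hmax (W₂ ⊔ M) ⟨W₁, hx₁, by
    rw [inf_sup_left, h₁₂, bot_sup_eq, ← le_bot_iff, ← hWM, ← hW]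
    exact inf_le_inf_right _ le_sup_left, by rw [← sup_assoc, hW, hU]⟩ h
  have hle : W₂ ≤ M := by
    by_contra h
    exact hM (lt_of_le_of_ne le_sup_right fun h' => h (h' ▸ le_sup_left))
  rw [← le_bot_iff, ← hWM, ← hW]
  exact le_inf le_sup_right hle

variable {F : Type u} [Field F] {X : Scheme.{u}}

/-- Extension by zero of a function from an open and closed subset. -/
lemma exists_res_eq_of_isCompl {U W M : X.Opens} (h : W ⊓ M = ⊥) (hU : W ⊔ M = U) (g : Γ(X, W)) :
    ∃ g' : Γ(X, U), res (hU ▸ le_sup_left) g' = g := by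
  subst hU
  let O : ULift.{u} Bool → X.Opens := fun b => if b.down then W else M
  have hO (b) : O b ≤ W ⊔ M := by
    rcases b with ⟨_ | _⟩
    · exact le_sup_right
    · exact le_sup_left
  let sf : ∀ b, Γ(X, O b)
    | ⟨true⟩ => g
    | ⟨false⟩ => (0 : Γ(X, M))
  obtain ⟨g', hg', -⟩ := X.sheaf.existsUnique_gluing' O (W ⊔ M) (fun b => homOfLE (hO b))
    (sup_le (le_iSup O ⟨true⟩) (le_iSup O ⟨false⟩)) sf (by
      rintro ⟨_ | _⟩ ⟨_ | _⟩
      · rfl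
      · have : Subsingleton Γ(X, O ⟨false⟩ ⊓ O ⟨true⟩) :=
          CommRingCat.subsingleton_of_isTerminal
            (X.sheaf.isTerminalOfEqEmpty (inf_comm W M ▸ h))
        exact this.elim _ _
      · have : Subsingleton Γ(X, O ⟨true⟩ ⊓ O ⟨false⟩) :=
          CommRingCat.subsingleton_of_isTerminal (X.sheaf.isTerminalOfEqEmpty h)
        exact this.elim _ _
      · rfl)
  exact ⟨g', hg' ⟨true⟩⟩

/-- A function on an indecomposable open subset with finitely many values is constant. -/
lemma eq_scalar_of_finite_values [IsReduced X] (π : X ⟶ Spec (CommRingCat.of F)) (W : X.Opens)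
    (x : X) (hx : x ∈ W)
    (hW : ∀ W₁ W₂ : X.Opens, x ∈ W₁ → W₁ ⊓ W₂ = ⊥ → W₁ ⊔ W₂ = W → W₂ = ⊥) (g : Γ(X, W))
    (S : Finset F) (hS : ∀ (y : X) (hy : y ∈ W), ∃ c ∈ S, X.evaluation W y hy g = scalarAt π y c) :
    ∃ c, g = scalar π W c := by
  classical
  have hmem (y : X) (hy : y ∈ W) (c : F) :
      y ∈ X.basicOpen (g - scalar π W c) ↔ X.evaluation W y hy g ≠ scalarAt π y c := by
    rw [← X.evaluation_ne_zero_iff_mem_basicOpen y hy, map_sub, evaluation_scalar, sub_ne_zero]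
  obtain ⟨c, hcS, hc⟩ := hS x hx
  -- `D(t)` is the locus of value `c` and `D(g - c)` that of the other values. They split `W`, so
  -- `D(g - c)` is empty, and reducedness gives `g = c`.
  let t : Γ(X, W) := ∏ c' ∈ S.erase c, (g - scalar π W c')
  have ht (y : X) (hy : y ∈ W) :
      y ∈ X.basicOpen t ↔ ∀ c' ∈ S.erase c, X.evaluation W y hy g ≠ scalarAt π y c' := by
    rw [← X.evaluation_ne_zero_iff_mem_basicOpen y hy]
    simp only [t, map_prod, Finset.prod_ne_zero_iff, map_sub, evaluation_scalar, sub_ne_zero]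
  have htc (y : X) (hy : y ∈ W) (h : X.evaluation W y hy g = scalarAt π y c) :
      y ∈ X.basicOpen t := by
    rw [ht y hy, h]
    exact fun c' hc' he => (Finset.mem_erase.mp hc').1 ((scalarAt π y).injective he).symm
  have h := hW (X.basicOpen t) (X.basicOpen (g - scalar π W c)) (htc x hx hc) ?_ ?_
  · refine ⟨c, sub_eq_zero.mp ?_⟩
    exact (basicOpen_eq_bot_iff _).mp h
  · rw [← le_bot_iff]
    rintro y ⟨h₁, h₂⟩
    have hy : y ∈ W := X.basicOpen_le _ h₁
    obtain ⟨c', hc', he⟩ := hS y hy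
    refine (ht y hy).mp h₁ c' (Finset.mem_erase.mpr ⟨?_, hc'⟩) he
    rintro rfl
    exact (hmem y hy c').mp h₂ he
  · refine le_antisymm (sup_le (X.basicOpen_le _) (X.basicOpen_le _)) fun y hy => ?_
    by_cases h : X.evaluation W y hy g = scalarAt π y c
    · exact Or.inl (htc y hy h)
    · exact Or.inr ((hmem y hy c).mpr h)

/-- A function that is constant at every generic point has finitely many values. -/
lemma exists_finset_of_generic_values [NoetherianSpace X] (π : X ⟶ Spec (CommRingCat.of F))
    (U : X.Opens) (g : Γ(X, U))
    (hg : ∀ (y : X) (hy : y ∈ U), closure {y} ∈ irreducibleComponents X →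
      ∃ c, X.evaluation U y hy g = scalarAt π y c) :
    ∃ S : Finset F, ∀ (y : X) (hy : y ∈ U), ∃ c ∈ S, X.evaluation U y hy g = scalarAt π y c := by
  have key : ∀ Z ∈ irreducibleComponents X, ∃ c : F, ∀ (y : X) (hy : y ∈ U), y ∈ Z →
      X.evaluation U y hy g = scalarAt π y c := by
    intro Z hZ
    obtain ⟨η, hη⟩ := QuasiSober.sober hZ.1 (isClosed_of_mem_irreducibleComponents Z hZ)
    by_cases hηU : η ∈ U
    · obtain ⟨c, hc⟩ := hg η hηU (hη.def.symm ▸ hZ)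
      refine ⟨c, fun y hy hyZ => ?_⟩
      by_contra h
      have hb : y ∈ X.basicOpen (g - scalar π U c) := by
        rwa [← X.evaluation_ne_zero_iff_mem_basicOpen y hy, map_sub, evaluation_scalar, sub_ne_zero]
      have hb' : η ∈ X.basicOpen (g - scalar π U c) := (hη.specializes hyZ).mem_open (X.basicOpen _).isOpen hb
      rw [← X.evaluation_ne_zero_iff_mem_basicOpen η hηU, map_sub, evaluation_scalar, sub_ne_zero]
        at hb'
      exact hb' hc
    -- A component whose generic point is outside `U` misses `U`, so the value 0 is arbitrary.
    · exact ⟨0, fun y hy hyZ => (hηU ((hη.specializes hyZ).mem_open U.isOpen hy)).elim⟩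
  choose! c hc using key
  have hfin := NoetherianSpace.finite_irreducibleComponents (α := X)
  refine ⟨(hfin.image c).toFinset, fun y hy => ⟨c (irreducibleComponent y), ?_, ?_⟩⟩
  · rw [Set.Finite.mem_toFinset]
    exact ⟨_, irreducibleComponent_mem_irreducibleComponents y, rfl⟩
  · exact hc _ (irreducibleComponent_mem_irreducibleComponents y) y hy mem_irreducibleComponent

/-- On a D-affine scheme, a function with an inverse on an open set `W` on which all functions are
constant is invertible at every specialization of the points of `W`. -/
lemma IsDAffine.mem_basicOpen_of_specializes [NoetherianSpace X] {π : X ⟶ Spec (CommRingCat.of F)}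
    (hD : IsDAffine π) (W : X.Opens) (hW : ∀ g : Γ(X, W), ∃ c, g = scalar π W c)
    (V : X.Opens) (s : Γ(X, V)) (hs : V ⊓ W ≤ X.basicOpen s) (x y : X) (hx : x ∈ V) (hy : y ∈ W)
    (hyx : y ⤳ x) : x ∈ X.basicOpen s := by
  have hu : IsUnit (res (inf_le_left : V ⊓ W ≤ V) s) := by
    have h := RingedSpace.isUnit_res_basicOpen X.toRingedSpace s
    have h' := h.map (res (V := X.basicOpen s) hs)
    exact (res_res (X.basicOpen_le s) hs s) ▸ h'
  obtain ⟨g, hg⟩ := hu.exists_left_inv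
  obtain ⟨V', hV', a, hxV', ha⟩ := hD.exists_res_eq W (fun g => by
    obtain ⟨c, rfl⟩ := hW g
    exact ⟨scalar π ⊤ c, res_scalar π _ c⟩) V g x hx
  by_contra hxs
  have hyV' := hyx.mem_open V'.isOpen hxV'
  -- The extension `a` of the inverse of `s` makes `a * s - 1` vanish at `y`, although it would be
  -- `-1` at the specialization `x`.
  have h₁ : X.evaluation V' y hyV' (a * res hV' s - 1) = 0 := by
    have h := congrArg (res (inf_le_inf_right W hV')) hg
    rw [map_mul, ← ha, res_res, map_one] at h
    have h' : res (inf_le_left : V' ⊓ W ≤ V') (a * res hV' s - 1) = 0 := by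
      rw [map_sub, map_mul, res_res, h, map_one, sub_self]
    rw [← evaluation_res inf_le_left y ⟨hyV', hy⟩, h', map_zero]
  have h₂ : X.evaluation V' x hxV' (a * res hV' s - 1) ≠ 0 := by
    rw [map_sub, map_mul, evaluation_res, (X.evaluation_eq_zero_iff_notMem_basicOpen x hx s).mpr hxs,
      mul_zero, map_one, zero_sub]
    exact neg_ne_zero.mpr one_ne_zero
  exact (X.evaluation_ne_zero_iff_mem_basicOpen y hyV' _).mpr
    (hyx.mem_open (X.basicOpen _).isOpen
      ((X.evaluation_ne_zero_iff_mem_basicOpen x hxV' _).mp h₂)) h₁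

end DAffinity

theorem mainTheorem2 {F : Type u} [Field F] [IsAlgClosed F] {X : Scheme.{u}}
    (π : X ⟶ Spec (CommRingCat.of F)) (hX : DAffinity.IsVariety π)
    (hproj : DAffinity.IsProjectiveOver π)
    (hdim : ∀ Z ∈ irreducibleComponents X, 2 ≤ topologicalKrullDim Z)
    (hD : DAffinity.IsDAffine π) :
    ¬ ∃ C : X.IdealSheafData, DAffinity.IsEffectiveCartier C ∧ (C.support : Set X).Nonempty ∧
      DAffinity.IsContractible π C := by
  open DAffinity in
  rintro ⟨C, hC, ⟨x, hxC⟩, Y, ρ, f, V, hρ, hf, hV, hCV, hiso⟩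
  have := hproj.universallyClosed
  have := hX.noetherianSpace
  have := hX.reduced
  have := hX.locallyOfFiniteType
  have := hρ.locallyOfFiniteType
  have hmemC (y : X) : y ∈ C.support ↔ y ∉ f ⁻¹ᵁ V := by
    rw [← SetLike.mem_coe, hCV]
    rfl
  have hsupp (O : X.affineOpens) (s) (hs : C.ideal O = Ideal.span {s}) (y : X) (hy : y ∈ O.1) :
      y ∈ C.support ↔ y ∉ X.basicOpen s := by
    rw [Scheme.IdealSheafData.mem_support_iff_of_mem hy, hs, Scheme.zeroLocus_span,
      Scheme.mem_zeroLocus_iff]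
    simp
  -- Local equations of `C` are not zero divisors, so `C` contains no generic point of `X`.
  have hgen (y : X) (hy : closure {y} ∈ irreducibleComponents X) : y ∈ f ⁻¹ᵁ V := by
    obtain ⟨O, hyO, s, hs, hCs⟩ := hC y
    have h := mem_basicOpen_of_mem_nonZeroDivisors y hy O.1 O.2 hyO s hs
    by_contra hyV
    exact (hsupp O s hCs y hyO).mp ((hmemC y).mpr hyV) h
  obtain ⟨η, hη⟩ := QuasiSober.sober (isIrreducible_irreducibleComponent (x := x))
    isClosed_irreducibleComponent
  have hηc : closure {η} ∈ irreducibleComponents X :=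
    hη.def.symm ▸ irreducibleComponent_mem_irreducibleComponents x
  obtain ⟨W, M, hηW, hWM, hWMU, hW⟩ := exists_indecomposable_open_nhd (f ⁻¹ᵁ V) η (hgen η hηc)
  have hWU : W ≤ f ⁻¹ᵁ V := hWMU ▸ le_sup_left
  have hconst (g : Γ(X, W)) : ∃ c, g = scalar π W c := by
    -- Extension by zero to `f ⁻¹ᵁ V`, because constancy at generic points is proved for functions
    -- on the full preimage.
    obtain ⟨g', rfl⟩ := exists_res_eq_of_isCompl hWM hWMU g
    obtain ⟨S, hS⟩ := exists_finset_of_generic_values π (f ⁻¹ᵁ V) g' fun y hy hyc => by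
      obtain ⟨A, _, _, _, i, hi, hiF, hA⟩ :=
        exists_injective_residueField_of_two_le_topologicalKrullDim π y (hdim _ hyc)
      exact exists_evaluation_eq_scalarAt π ρ f hf V hV y hy i hi hiF hA g'
    refine eq_scalar_of_finite_values π W η hηW hW _ S fun y hy => ?_
    obtain ⟨c, hc, h⟩ := hS y (hWU hy)
    exact ⟨c, hc, (evaluation_res hWU y hy g').trans h⟩
  obtain ⟨O, hxO, s, -, hCs⟩ := hC x
  refine (hsupp O s hCs x hxO).mp hxC (hD.mem_basicOpen_of_specializes W hconst O.1 s ?_ x η hxO hηW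
    (hη.specializes mem_irreducibleComponent))
  rintro y ⟨hyO, hyW⟩
  by_contra h
  exact (hmemC y).mp ((hsupp O s hCs y hyO).mpr h) (hWU hyW)
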